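/- Let $d\ge 2$ and $\mathbb{T}=\mathbb{R}/\mathbb{Z}$. Let $R_d=\mathbb{Z}[u_1^{\pm1},\dots,u_d^{\pm1}]$, and write $h\in R_d$ as $h=\sum_{\mathbf n\in\mathbb{Z}^d}h_{\mathbf n}u^{\mathbf n}$. For $w\in\mathbb{R}^{\mathbb{Z}^d}$ put $(h\cdot w)_{\mathbf n}=\sum_{\mathbf m}h_{\mathbf m}w_{\mathbf n-\mathbf m}$; for $x\in\mathbb{T}^{\mathbb{Z}^d}$ put $(h(\alpha)x)_{\mathbf n}=\sum_{\mathbf m}h_{\mathbf m}x_{\mathbf m+\mathbf n}$. Let $\rho\colon\mathbb{R}^{\mathbb{Z}^d}\to\mathbb{T}^{\mathbb{Z}^d}$ be coordinatewise reduction mod $1$, let $\ell^\infty(\mathbb{Z}^d)$ be the set of bounded elements of $\mathbb{R}^{\mathbb{Z}^d}$ and $\ell^\infty(\mathbb{Z}^d,\mathbb{Z})$ the set of its integer-valued elements. For $c\in\mathbb{R}$ let $\tilde c\in\mathbb{R}^{\mathbb{Z}^d}$ be the constant element with value $c$. Let $f^{(d)}=2d-\sum_{i=1}^d(u_i+u_i^{-1})$,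 let $F^{(d)}(\mathbf t)=2d-2\sum_{j=1}^d\cos(2\pi t_j)$ for $\mathbf t\in\mathbb{T}^d$, and define $w^{(d)}\in\mathbb{R}^{\mathbb{Z}^d}$ by $$w^{(2)}_{\mathbf n}=\int_{\mathbb{T}^2}\frac{e^{-2\pi i\langle\mathbf n,\mathbf t\rangle}-1}{F^{(2)}(\mathbf t)}\,d\mathbf t,\qquad w^{(d)}_{\mathbf n}=\int_{\mathbb{T}^d}\frac{e^{-2\pi i\langle\mathbf n,\mathbf t\rangle}}{F^{(d)}(\mathbf t)}\,d\mathbf t\quad(d\ge3).$$ Put $I_d=\{g\in R_d:g\cdot w^{(d)}\in\ell^1(\mathbb{Z}^d)\}$. For $g\in I_d$ and $v\in\ell^\infty(\mathbb{Z}^d)$ let $\xi_g(v)=\rho(\bar\xi_g(v))$, where $\bar\xi_g(v)_{\mathbf n}=\sum_{\mathbf m\in\mathbb{Z}^d}(g\cdot w^{(d)})_{\mathbf m}v_{\mathbf m+\mathbf n}$, and let $$K_d=\{v\in\ell^\infty(\mathbb{Z}^d,\mathbb{Z}):\xi_g(v)=0\text{ for every }g\in I_d\}.$$ Let $\mathscr{I}_d=\{h\in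 R_d:h(1,\dots,1)=0\}$, and for an ideal $J\subset R_d$ let $X_J=\{x\in\mathbb{T}^{\mathbb{Z}^d}:g(\alpha)x=0\text{ for every }g\in J\}$. For every $y\in\ell^\infty(\mathbb{Z}^d)$ with $\rho(y)\in X_{\mathscr{I}_d^3}$ there is a unique $c(y)\in[0,1)$ with $f^{(d)}\cdot y+\tilde c(y)\in\ell^\infty(\mathbb{Z}^d,\mathbb{Z})$, where $\tilde c(y)$ is the constant element with value $c(y)$. **Theorem.** (1) For every $y\in\ell^\infty(\mathbb{Z}^d)$ with $\rho(y)\in X_{\mathscr{I}_d^3}$ and every $m\in\mathbb{Z}$, $$v=f^{(d)}\cdot y+\tilde c(y)+\tilde m\in K_d.\qquad(*)$$ (2) Let $\Gamma\subset\mathbb{Z}^d$ be a subgroup of finite index. A $\Gamma$-invariant element $v\in\ell^\infty(\mathbb{Z}^d,\mathbb{Z})$ (that is, $v_{\gamma+\mathbf n}=v_{\mathbf n}$ for all $\gamma\in\Gamma$, $\mathbf n\in\mathbb{Z}^d$) lies in $K_d$ if and only if it is of the form $(*)$ for some $\Gamma$-invariant $y\in\ell^\infty(\mathbb{Z}^d)$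 with $\rho(y)\in X_{\mathscr{I}_d^3}$ and some $m\in\mathbb{Z}$. -/

import Mathlib

open scoped ENNReal

namespace HarmonicModel

/-- The ring `R_d = ℤ[u₁^{±1}, …, u_d^{±1}]` of integer Laurent polynomials in `d` variables: the
group ring of `ℤ^d`, in which `single n a` is the monomial `a u^n`. -/
abbrev R (d : ℕ) : Type := AddMonoidAlgebra ℤ (Fin d → ℤ)

/-- The space `W_d = ℝ^{ℤ^d}`. -/
abbrev W (d : ℕ) : Type := (Fin d → ℤ) → ℝ

/-- The group `𝕋^{ℤ^d}`, where `𝕋 = ℝ/ℤ`. -/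
abbrev TZ (d : ℕ) : Type := (Fin d → ℤ) → UnitAddCircle

/-- The monomial `u^n`. -/
noncomputable def mono {d : ℕ} (n : Fin d → ℤ) : R d := AddMonoidAlgebra.single n 1

/-- The product `h · w = ∑ₘ hₘ u^m · w` of a Laurent polynomial `h` and `w ∈ W_d`, where
`(u^m · w)ₙ = w_{n-m}`. -/
noncomputable def mulW {d : ℕ} (h : R d) (w : W d) : W d :=
  fun n => h.coeff.sum fun m a => (a : ℝ) * w (n - m)

/-- The homomorphism `h(α) = ∑ₘ hₘ α^m` of `𝕋^{ℤ^d}`, where `(α^m x)ₙ = x_{m+n}`. -/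
noncomputable def evalAlpha {d : ℕ} (h : R d) (x : TZ d) : TZ d :=
  fun n => h.coeff.sum fun m a => a • x (m + n)

/-- The operator `h(σ) = ∑ₘ hₘ σ^m`, where `(σ^m w)ₙ = w_{m+n}`, for `h ∈ ℓ¹(ℤ^d)`; the sum
converges coordinatewise for every bounded `w`. -/
noncomputable def evalSigma {d : ℕ} (h w : W d) : W d :=
  fun n => ∑' m, h m * w (m + n)

/-- The reduction `ρ : W_d → 𝕋^{ℤ^d}` of every coordinate mod 1. -/
def rho {d : ℕ} (w : W d) : TZ d := fun n => (w n : UnitAddCircle)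

/-- The constant element of `W_d` with value `c`. -/
def const {d : ℕ} (c : ℝ) : W d := fun _ => c

/-- The space `ℓ¹(ℤ^d)`. -/
def ellOne (d : ℕ) : Set (W d) := {w | Memℓp (E := fun _ => ℝ) w 1}

/-- The space `ℓ^∞(ℤ^d)`. -/
def ellInf (d : ℕ) : Set (W d) := {w | Memℓp (E := fun _ => ℝ) w ∞}

/-- The group `ℓ^∞(ℤ^d, ℤ)` of bounded elements of `W_d` with integer coordinates. -/
def ellInfInt (d : ℕ) : Set (W d) := {w | w ∈ ellInf d ∧ ∀ n, ∃ k : ℤ, w n = k}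

/-- Invariance of `w ∈ W_d` under the shifts by elements of the subgroup `Γ`. -/
def IsInvariant {d : ℕ} (Γ : AddSubgroup (Fin d → ℤ)) (w : W d) : Prop :=
  ∀ γ ∈ Γ, ∀ n, w (γ + n) = w n

/-- The Laurent polynomial `f^{(d)} = 2d - ∑ᵢ (uᵢ + uᵢ⁻¹)`. -/
noncomputable def f (d : ℕ) : R d :=
  ((2 * d : ℕ) : R d) - ∑ i : Fin d, (mono (Pi.single i 1) + mono (-Pi.single i 1))

/-- The Fourier transform `F^{(d)}(t) = ∑ₙ f^{(d)}ₙ e^{2πi⟨n,t⟩}` of `f^{(d)}` on `𝕋^d`. -/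
noncomputable def F (d : ℕ) (t : UnitAddTorus (Fin d)) : ℂ :=
  (f d).coeff.sum fun n a => (a : ℂ) * UnitAddTorus.mFourier n t

/-- The normalized Haar measure of `𝕋^d`. -/
noncomputable def haarTorus (d : ℕ) : MeasureTheory.Measure (UnitAddTorus (Fin d)) :=
  MeasureTheory.Measure.pi fun _ => AddCircle.haarAddCircle

/-- The integral that defines the `n`-th coordinate of the fundamental solution `w^{(d)}` of
`f^{(d)} · w = 1`; for `d = 2` the numerator is `e^{-2πi⟨n,t⟩} - 1`, otherwise `e^{-2πi⟨n,t⟩}`. -/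
noncomputable def greenIntegral (d : ℕ) (n : Fin d → ℤ) : ℂ :=
  if d = 2 then ∫ t, (UnitAddTorus.mFourier (-n) t - 1) / F d t ∂(haarTorus d)
  else ∫ t, UnitAddTorus.mFourier (-n) t / F d t ∂(haarTorus d)

/-- The fundamental solution `w^{(d)} ∈ W_d` (the integrals are real, see
`greenIntegral_eq_green`). -/
noncomputable def green (d : ℕ) : W d := fun n => (greenIntegral d n).re

/-- `I_d = {g ∈ R_d : g · w^{(d)} ∈ ℓ¹(ℤ^d)}`. -/
def I (d : ℕ) : Set (R d) := {g | mulW g (green d) ∈ ellOne d}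

/-- The map `ξ̄_g = (g · w^{(d)})(σ)`; it is meant for `g ∈ I_d` and bounded arguments. -/
noncomputable def xiBar {d : ℕ} (g : R d) (w : W d) : W d := evalSigma (mulW g (green d)) w

/-- The map `ξ_g = ρ ∘ ξ̄_g`. -/
noncomputable def xi {d : ℕ} (g : R d) (w : W d) : TZ d := rho (xiBar g w)

/-- The common kernel `K_d = ⋂_{g ∈ I_d} ker ξ_g` of the maps `ξ_g` on `ℓ^∞(ℤ^d, ℤ)`. -/
def K (d : ℕ) : Set (W d) := {v | v ∈ ellInfInt d ∧ ∀ g ∈ I d, xi g v = 0}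

/-- Evaluation of Laurent polynomials at `𝟏 = (1, …, 1)`. -/
noncomputable def evalOne (d : ℕ) : R d →+* ℤ :=
  (AddMonoidAlgebra.lift ℤ ℤ (Fin d → ℤ) 1 : R d →ₐ[ℤ] ℤ)

/-- The ideal `𝓘_d = {h ∈ R_d : h(𝟏) = 0}`. -/
noncomputable def augIdeal (d : ℕ) : Ideal (R d) := RingHom.ker (evalOne d)

/-- The group `X_J = {x ∈ 𝕋^{ℤ^d} : g(α)(x) = 0 for every g ∈ J}` of an ideal `J`. -/
def X {d : ℕ} (J : Ideal (R d)) : Set (TZ d) := {x | ∀ g ∈ J, evalAlpha g x = 0}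

/-! ### Facts that the definitions rest on -/

theorem mFourier_apply_neg {d : ℕ} (n : Fin d → ℤ) (t : UnitAddTorus (Fin d)) :
    UnitAddTorus.mFourier n (-t) = (starRingEnd ℂ) (UnitAddTorus.mFourier n t) := by
  rw [← UnitAddTorus.mFourier_neg]
  simp [UnitAddTorus.mFourier, fourier_apply]

theorem F_neg {d : ℕ} (t : UnitAddTorus (Fin d)) : F d (-t) = (starRingEnd ℂ) (F d t) := by
  simp [F, Finsupp.sum, mFourier_apply_neg]

theorem conj_integral_haarTorus {d : ℕ} (g : UnitAddTorus (Fin d) → ℂ)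
    (hg : ∀ t, g (-t) = (starRingEnd ℂ) (g t)) :
    (starRingEnd ℂ) (∫ t, g t ∂(haarTorus d)) = ∫ t, g t ∂(haarTorus d) := by
  have : (AddCircle.haarAddCircle (T := (1 : ℝ))).IsNegInvariant := by
    unfold AddCircle.haarAddCircle
    infer_instance
  have : (haarTorus d).IsNegInvariant := by
    unfold haarTorus
    infer_instance
  rw [← integral_conj, ← MeasureTheory.integral_neg_eq_self g (haarTorus d)]
  simp only [hg]

theorem greenIntegral_eq_green (d : ℕ) (n : Fin d → ℤ) : greenIntegral d n = (green d n : ℂ) := by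
  rw [eq_comm, green, ← Complex.conj_eq_iff_re, greenIntegral]
  split_ifs
  · exact conj_integral_haarTorus _ fun t => by simp [F_neg, mFourier_apply_neg]
  · exact conj_integral_haarTorus _ fun t => by simp [F_neg, mFourier_apply_neg]

theorem summable_xiBar {d : ℕ} {g : R d} (hg : g ∈ I d) {w : W d} (hw : w ∈ ellInf d)
    (n : Fin d → ℤ) : Summable fun m => mulW g (green d) m * w (m + n) := by
  have h1 : Summable fun m => ‖mulW g (green d) m‖ := by
    have h := (memℓp_gen_iff (E := fun _ => ℝ) (p := 1) (by simp)).1 hg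
    simpa using h
  obtain ⟨C, hC⟩ := memℓp_infty_iff.1 hw
  refine Summable.of_norm_bounded (h1.mul_right C) fun m => ?_
  rw [norm_mul]
  exact mul_le_mul_of_nonneg_left (hC ⟨m + n, rfl⟩) (norm_nonneg _)

theorem evalOne_mono {d : ℕ} (n : Fin d → ℤ) : evalOne d (mono n) = 1 := by
  simp [evalOne, mono]

theorem evalAlpha_add {d : ℕ} (g h : R d) (x : TZ d) :
    evalAlpha (g + h) x = evalAlpha g x + evalAlpha h x := by
  funext n
  simp only [evalAlpha, Pi.add_apply, AddMonoidAlgebra.coeff_add]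
  exact Finsupp.sum_add_index' (by simp) (by intros; rw [add_smul])

theorem evalAlpha_single {d : ℕ} (m : Fin d → ℤ) (a : ℤ) (x : TZ d) (n : Fin d → ℤ) :
    evalAlpha (AddMonoidAlgebra.single m a) x n = a • x (m + n) := by
  simp [evalAlpha, AddMonoidAlgebra.coeff_single]

theorem evalAlpha_zero {d : ℕ} (x : TZ d) : evalAlpha (0 : R d) x = 0 := by
  funext n
  simp [evalAlpha]

theorem evalAlpha_sub {d : ℕ} (g h : R d) (x : TZ d) :
    evalAlpha (g - h) x = evalAlpha g x - evalAlpha h x := by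
  rw [eq_sub_iff_add_eq, ← evalAlpha_add, sub_add_cancel]

theorem evalAlpha_mono_mul {d : ℕ} (m : Fin d → ℤ) (h : R d) (x : TZ d) (n : Fin d → ℤ) :
    evalAlpha (mono m * h) x n = evalAlpha h x (m + n) := by
  induction h using AddMonoidAlgebra.induction_linear with
  | zero => simp [evalAlpha_zero]
  | add p q hp hq => simp only [mul_add, evalAlpha_add, Pi.add_apply, hp, hq]
  | single k a =>
    rw [mono, AddMonoidAlgebra.single_mul_single, evalAlpha_single, evalAlpha_single, one_mul]
    congr 2
    abel

/-- `f^{(d)} = ∑ᵢ (uᵢ - 1)(uᵢ⁻¹ - 1)`. -/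
theorem f_eq (d : ℕ) :
    f d = ∑ i : Fin d, (mono (Pi.single i 1) - 1) * (mono (-Pi.single i 1) - 1) := by
  have h : ∀ i : Fin d, (mono (Pi.single i 1) - 1) * (mono (-Pi.single i 1) - 1)
      = (2 : R d) - (mono (Pi.single i 1) + mono (-Pi.single i 1)) := by
    intro i
    have h1 : (mono (Pi.single i 1) : R d) * mono (-Pi.single i 1) = 1 := by
      rw [mono, mono, AddMonoidAlgebra.single_mul_single, add_neg_cancel, one_mul]
      rfl
    linear_combination h1
  rw [Finset.sum_congr rfl fun i _ => h i, Finset.sum_sub_distrib, f]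
  simp [mul_comm]

theorem mono_sub_one_mem {d : ℕ} (n : Fin d → ℤ) : mono n - 1 ∈ augIdeal d := by
  rw [augIdeal, RingHom.mem_ker, map_sub, evalOne_mono, map_one, sub_self]

theorem mono_sub_one_mul_f_mem {d : ℕ} (n : Fin d → ℤ) : (mono n - 1) * f d ∈ augIdeal d ^ 3 := by
  rw [f_eq, pow_succ', pow_two]
  exact Ideal.mul_mem_mul (mono_sub_one_mem _) (Ideal.sum_mem _ fun i _ =>
    Ideal.mul_mem_mul (mono_sub_one_mem _) (mono_sub_one_mem _))

theorem evalAlpha_f_const {d : ℕ} {x : TZ d} (hx : x ∈ X (augIdeal d ^ 3)) (n : Fin d → ℤ) :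
    evalAlpha (f d) x n = evalAlpha (f d) x 0 := by
  have h := congrFun (hx _ (mono_sub_one_mul_f_mem n)) 0
  rw [sub_mul, one_mul, evalAlpha_sub, Pi.sub_apply, evalAlpha_mono_mul, add_zero] at h
  exact sub_eq_zero.1 h

theorem mulW_add {d : ℕ} (g h : R d) (w : W d) : mulW (g + h) w = mulW g w + mulW h w := by
  funext n
  simp only [mulW, Pi.add_apply, AddMonoidAlgebra.coeff_add]
  exact Finsupp.sum_add_index' (by simp) (by intros; push_cast; ring)

theorem mulW_single {d : ℕ} (m : Fin d → ℤ) (a : ℤ) (w : W d) (n : Fin d → ℤ) :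
    mulW (AddMonoidAlgebra.single m a) w n = a * w (n - m) := by
  simp [mulW, AddMonoidAlgebra.coeff_single]

theorem mulW_sub {d : ℕ} (g h : R d) (w : W d) : mulW (g - h) w = mulW g w - mulW h w := by
  rw [eq_sub_iff_add_eq, ← mulW_add, sub_add_cancel]

theorem mulW_sum {d : ℕ} {ι : Type} (s : Finset ι) (g : ι → R d) (w : W d) :
    mulW (∑ i ∈ s, g i) w = ∑ i ∈ s, mulW (g i) w :=
  map_sum (AddMonoidHom.mk' (fun g : R d => mulW g w) fun g h => mulW_add g h w) g s

theorem evalAlpha_sum {d : ℕ} {ι : Type} (s : Finset ι) (g : ι → R d) (x : TZ d) :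
    evalAlpha (∑ i ∈ s, g i) x = ∑ i ∈ s, evalAlpha (g i) x :=
  map_sum (AddMonoidHom.mk' (fun g : R d => evalAlpha g x) fun g h => evalAlpha_add g h x) g s

theorem natCast_eq {d : ℕ} (k : ℕ) : (k : R d) = AddMonoidAlgebra.single 0 (k : ℤ) := rfl

theorem mulW_f {d : ℕ} (w : W d) (n : Fin d → ℤ) :
    mulW (f d) w n = 2 * d * w n - ∑ i, (w (n + Pi.single i 1) + w (n - Pi.single i 1)) := by
  simp only [f, mulW_sub, natCast_eq, mono, mulW_sum, mulW_add, Pi.sub_apply, mulW_single,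
    Finset.sum_apply, Pi.add_apply]
  simp [add_comm]

theorem evalAlpha_f {d : ℕ} (x : TZ d) (n : Fin d → ℤ) :
    evalAlpha (f d) x n
      = (2 * d : ℕ) • x n - ∑ i, (x (n + Pi.single i 1) + x (n - Pi.single i 1)) := by
  simp only [f, evalAlpha_sub, natCast_eq, mono, evalAlpha_sum, evalAlpha_add, Pi.sub_apply,
    evalAlpha_single, Finset.sum_apply, Pi.add_apply, one_smul, zero_add, natCast_zsmul]
  congr 1
  refine Finset.sum_congr rfl fun i _ => ?_
  rw [add_comm (Pi.single i 1) n, sub_eq_neg_add]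

theorem rho_mulW_f {d : ℕ} (y : W d) : rho (mulW (f d) y) = evalAlpha (f d) (rho y) := by
  funext n
  rw [evalAlpha_f]
  simp only [rho, mulW_f]
  have h : (2 * (d : ℝ) * y n) = (2 * d : ℕ) • y n := by simp
  rw [h]
  have hs : ∀ g : Fin d → ℝ, ((∑ i, g i : ℝ) : UnitAddCircle) = ∑ i, (g i : UnitAddCircle) :=
    fun g => map_sum (QuotientAddGroup.mk' (AddSubgroup.zmultiples (1 : ℝ))) g Finset.univ
  rw [AddCircle.coe_sub, hs]
  rfl

theorem mulW_f_bounded {d : ℕ} {y : W d} (hy : y ∈ ellInf d) (c : ℝ) :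
    mulW (f d) y + const c ∈ ellInf d := by
  obtain ⟨C, hC⟩ := memℓp_infty_iff.1 hy
  refine memℓp_infty ⟨2 * d * C + ∑ _i : Fin d, (C + C) + ‖c‖, ?_⟩
  rintro _ ⟨n, rfl⟩
  have hb : ∀ k, ‖y k‖ ≤ C := fun k => hC ⟨k, rfl⟩
  simp only [Pi.add_apply, const, mulW_f]
  refine (norm_add_le _ _).trans (add_le_add ((norm_sub_le _ _).trans (add_le_add ?_ ?_)) le_rfl)
  · rw [norm_mul, norm_mul]
    simp only [Real.norm_ofNat, Real.norm_natCast]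
    exact mul_le_mul_of_nonneg_left (hb n) (by positivity)
  · exact norm_sum_le_of_le _ fun i _ => (norm_add_le _ _).trans (add_le_add (hb _) (hb _))

/-- For bounded `y` with `ρ(y) ∈ X_{𝓘_d³}` there is a unique `c ∈ [0,1)` such that
`f^{(d)} · y + c` lies in `ℓ^∞(ℤ^d, ℤ)`. -/
theorem existsUnique_const {d : ℕ} {y : W d} (hy : y ∈ ellInf d)
    (hX : rho y ∈ X (augIdeal d ^ 3)) :
    ∃! c : ℝ, c ∈ Set.Ico (0 : ℝ) 1 ∧ mulW (f d) y + const c ∈ ellInfInt d := by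
  refine ⟨Int.fract (-mulW (f d) y 0), ⟨⟨Int.fract_nonneg _, Int.fract_lt_one _⟩,
    mulW_f_bounded hy _, fun n => ?_⟩, ?_⟩
  · have h : ((mulW (f d) y n : ℝ) : UnitAddCircle) = (mulW (f d) y 0 : ℝ) := by
      have h1 := evalAlpha_f_const hX n
      rw [← rho_mulW_f] at h1
      exact h1
    rw [← sub_eq_zero, ← AddCircle.coe_sub, AddCircle.coe_eq_zero_iff] at h
    obtain ⟨k, hk⟩ := h
    refine ⟨k - ⌊-mulW (f d) y 0⌋, ?_⟩
    have h2 := Int.self_sub_floor (-mulW (f d) y 0)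
    simp only [Pi.add_apply, const]
    rw [zsmul_one] at hk
    push_cast
    linarith
  · rintro c ⟨hc, -, hc'⟩
    obtain ⟨k, hk⟩ := hc' 0
    simp only [Pi.add_apply, const] at hk
    symm
    rw [Int.fract_eq_iff]
    exact ⟨hc.1, hc.2, -k, by push_cast; linarith⟩

/-- The constant `c(y) ∈ [0,1)` of a bounded `y` with `ρ(y) ∈ X_{𝓘_d³}`: the unique one for which
`f^{(d)} · y + c(y)` lies in `ℓ^∞(ℤ^d, ℤ)`. -/
noncomputable def cst {d : ℕ} (y : W d) (hy : y ∈ ellInf d)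
    (hX : rho y ∈ X (augIdeal d ^ 3)) : ℝ :=
  Classical.choose (existsUnique_const hy hX).exists

theorem cst_spec {d : ℕ} (y : W d) (hy : y ∈ ellInf d) (hX : rho y ∈ X (augIdeal d ^ 3)) :
    cst y hy hX ∈ Set.Ico (0 : ℝ) 1 ∧ mulW (f d) y + const (cst y hy hX) ∈ ellInfInt d :=
  Classical.choose_spec (existsUnique_const hy hX).exists

end HarmonicModel

/-!
The ideal `I_d` consists of the `g` for which `f · h = g` has a solution `h ∈ ℓ¹`, and this solution
is then `h = g · w` (`mulW_green_eq`, `mulW_f_mulW_green`). On the side of the Fourier transform,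
`ĝ = F ĥ` with `ĥ` continuous, and `F(t) = ∑ⱼ |e^{2πi tⱼ} - 1|²` vanishes only at `0`, to second
order. The theorem rests on two facts about `I_d`, which amount to `I_d = (f) + 𝓘_d³`.

* If `g ∈ I_d`, then the Taylor polynomial of degree 2 of `ĝ` at `0` is `ĥ(0)` times that of `F`. As
  the classes modulo `𝓘_d³` are determined by these Taylor polynomials, `g ≡ a f` modulo `𝓘_d³` with
  the integer `a = ĥ(0) = ∑ h` (`exists_sub_mul_f_mem`).
* `𝓘_d³ ⊆ I_d` (`mem_I_of_mem_augIdeal_pow`). Let `p` be the law of one step of the lazy simple random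
  walk, so that `f = 4d (1 - p)`. The solution is `h = (4d)⁻¹ ∑ₖ g pᵏ`, and the series converges
  absolutely in `ℓ¹` because each factor of `g` from the augmentation ideal gains `k^{-1/2}`
  (`exists_l1Norm_mul_lazyWalk_pow_le`): for three factors the norms are `O(k^{-3/2})`. The gain of
  one factor `1 - u` comes from the binomial theorem and the variance of the binomial distribution
  (`l1Norm_one_sub_mul_pow_le`).

For bounded `y`, summation by parts gives `ξ_g(f · y + c) = g(α) ρ(y) + c ∑ h`
(`xi_mulW_f_add_const`). If `ρ(y) ∈ X_{𝓘_d³}` and `g ≡ a f`, then `g(α) ρ(y) = a ρ(f · y)`, so that the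
right-hand side is `a ρ(f · y + c)`, which vanishes if `f · y + c` is integer-valued. Conversely, a
`Γ`-invariant `v` is of the form `f · y + c` with `Γ`-invariant `y`, by the maximum principle on the
finite group `ℤ^d/Γ` (`exists_invariant_solution`). If `v ∈ K_d`, then for `g ∈ 𝓘_d³` the formula,
with `∑ h = 0`, gives `g(α) ρ(y) = 0`, which means that `ρ(y) ∈ X_{𝓘_d³}`.
-/

open scoped ENNReal

namespace HarmonicModel

/-! ### The `ℓ¹`-norm on the real group ring and smoothing by random walks -/

section L1Norm

variable {G : Type*}

/-- The `ℓ¹`-norm `∑ₙ |aₙ|` of an element of the real group ring. -/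
noncomputable def l1Norm (a : AddMonoidAlgebra ℝ G) : ℝ := a.coeff.sum fun _ r => |r|

theorem l1Norm_nonneg (a : AddMonoidAlgebra ℝ G) : 0 ≤ l1Norm a :=
  Finset.sum_nonneg fun _ _ => abs_nonneg _

theorem l1Norm_zero : l1Norm (0 : AddMonoidAlgebra ℝ G) = 0 := by simp [l1Norm]

theorem l1Norm_single (m : G) (r : ℝ) : l1Norm (AddMonoidAlgebra.single m r) = |r| := by
  simp [l1Norm, AddMonoidAlgebra.coeff_single]

theorem l1Norm_eq_sum {a : AddMonoidAlgebra ℝ G} {s : Finset G} (h : a.coeff.support ⊆ s) :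
    l1Norm a = ∑ n ∈ s, |a.coeff n| :=
  Finsupp.sum_of_support_subset _ h _ (by simp)

theorem sum_abs_coeff_le_l1Norm (a : AddMonoidAlgebra ℝ G) (s : Finset G) :
    ∑ n ∈ s, |a.coeff n| ≤ l1Norm a := by
  classical
  rw [l1Norm_eq_sum (s := s ∪ a.coeff.support) Finset.subset_union_right]
  exact Finset.sum_le_sum_of_subset_of_nonneg Finset.subset_union_left
    fun _ _ _ => abs_nonneg _

theorem l1Norm_add_le (a b : AddMonoidAlgebra ℝ G) : l1Norm (a + b) ≤ l1Norm a + l1Norm b := by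
  classical
  have hs : (a + b).coeff.support ⊆ a.coeff.support ∪ b.coeff.support := Finsupp.support_add
  rw [l1Norm_eq_sum hs, l1Norm_eq_sum (s := a.coeff.support ∪ b.coeff.support)
    Finset.subset_union_left, l1Norm_eq_sum (s := a.coeff.support ∪ b.coeff.support)
    Finset.subset_union_right, ← Finset.sum_add_distrib]
  exact Finset.sum_le_sum fun n _ => abs_add_le _ _

theorem l1Norm_sum_le {ι : Type*} (s : Finset ι) (a : ι → AddMonoidAlgebra ℝ G) :
    l1Norm (∑ i ∈ s, a i) ≤ ∑ i ∈ s, l1Norm (a i) := by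
  classical
  induction s using Finset.induction_on with
  | empty => simp [l1Norm_zero]
  | insert i s hi ih =>
    rw [Finset.sum_insert hi, Finset.sum_insert hi]
    exact (l1Norm_add_le _ _).trans (by gcongr)

theorem l1Norm_smul (c : ℝ) (a : AddMonoidAlgebra ℝ G) : l1Norm (c • a) = |c| * l1Norm a := by
  have hs : (c • a).coeff.support ⊆ a.coeff.support := Finsupp.support_smul
  rw [l1Norm_eq_sum hs, l1Norm_eq_sum subset_rfl, Finset.mul_sum]
  simp [abs_mul]

variable [AddCommMonoid G]

theorem l1Norm_one : l1Norm (1 : AddMonoidAlgebra ℝ G) = 1 := by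
  rw [AddMonoidAlgebra.one_def, l1Norm_single, abs_one]

theorem l1Norm_mul_le (a b : AddMonoidAlgebra ℝ G) : l1Norm (a * b) ≤ l1Norm a * l1Norm b := by
  rw [AddMonoidAlgebra.mul_def, Finsupp.sum]
  refine (l1Norm_sum_le _ _).trans ?_
  rw [l1Norm, Finsupp.sum, Finset.sum_mul]
  refine Finset.sum_le_sum fun m _ => ?_
  rw [Finsupp.sum]
  refine (l1Norm_sum_le _ _).trans ?_
  rw [l1Norm, Finsupp.sum, Finset.mul_sum]
  exact Finset.sum_le_sum fun n _ => by rw [l1Norm_single, abs_mul]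

theorem l1Norm_pow_le (a : AddMonoidAlgebra ℝ G) (k : ℕ) : l1Norm (a ^ k) ≤ l1Norm a ^ k := by
  induction k with
  | zero => simp [l1Norm_one]
  | succ k ih =>
    rw [pow_succ, pow_succ]
    exact (l1Norm_mul_le _ _).trans (mul_le_mul_of_nonneg_right ih (l1Norm_nonneg _))

end L1Norm

/-- The derivative of the binomial theorem: `(1 - u)(1 + u)^j`, up to the factor `j + 1`, is
`∑ᵢ C(j+1,i) (j+1-2i) uⁱ`. -/
theorem succ_mul_one_sub_mul_one_add_pow {A : Type*} [CommRing A] (u : A) (j : ℕ) :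
    ((j + 1 : ℕ) : A) * ((1 - u) * (1 + u) ^ j)
      = ∑ i ∈ Finset.range (j + 2), ((j + 1).choose i : A) * ((j + 1 : ℕ) - 2 * i) * u ^ i := by
  have h1 : (1 + u) ^ (j + 1)
      = ∑ i ∈ Finset.range (j + 2), ((j + 1).choose i : A) * u ^ i := by
    rw [add_comm, add_pow]
    exact Finset.sum_congr rfl fun i _ => by rw [one_pow]; ring
  have h2 : ((j + 1 : ℕ) : A) * (u * (1 + u) ^ j)
      = ∑ i ∈ Finset.range (j + 2), ((j + 1).choose i : A) * i * u ^ i := by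
    rw [Finset.sum_range_succ', add_comm 1 u, add_pow, Finset.mul_sum, Finset.mul_sum]
    simp only [Nat.cast_zero, mul_zero, zero_mul, add_zero]
    refine Finset.sum_congr rfl fun i _ => ?_
    have h := congrArg (Nat.cast (R := A)) (Nat.add_one_mul_choose_eq j i)
    push_cast at h ⊢
    rw [one_pow]
    linear_combination u ^ (i + 1) * h
  calc ((j + 1 : ℕ) : A) * ((1 - u) * (1 + u) ^ j)
      = ((j + 1 : ℕ) : A) * (1 + u) ^ (j + 1)
        - 2 * (((j + 1 : ℕ) : A) * (u * (1 + u) ^ j)) := by ring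
    _ = _ := by
      rw [h1, h2, Finset.mul_sum, Finset.mul_sum, ← Finset.sum_sub_distrib]
      exact Finset.sum_congr rfl fun i _ => by ring

/-- The variance of the binomial distribution with parameters `n` and `1/2`. -/
theorem sum_choose_mul_sq (n : ℕ) :
    ∑ i ∈ Finset.range (n + 1), (n.choose i : ℝ) * ((n : ℝ) - 2 * i) ^ 2 = (2 : ℝ) ^ n * n := by
  have h := congrArg (Polynomial.eval (1 / 2 : ℝ)) (bernsteinPolynomial.variance ℝ n)
  simp only [Polynomial.eval_finsetSum, bernsteinPolynomial, Polynomial.eval_mul,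
    Polynomial.eval_pow, Polynomial.eval_sub, Polynomial.eval_X,
    Polynomial.eval_natCast, Polynomial.eval_one, nsmul_eq_mul] at h
  have h' : ∑ i ∈ Finset.range (n + 1), (n.choose i : ℝ) * ((n : ℝ) - 2 * i) ^ 2
      = 4 * 2 ^ n * ∑ i ∈ Finset.range (n + 1), ((n : ℝ) * (1 / 2) - i) ^ 2
        * ((n.choose i : ℝ) * (1 / 2) ^ i * (1 - 1 / 2) ^ (n - i)) := by
    rw [Finset.mul_sum]
    refine Finset.sum_congr rfl fun i hi => ?_
    have hi : i ≤ n := Nat.lt_succ_iff.1 (Finset.mem_range.1 hi)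
    have h2 : (1 / 2 : ℝ) ^ i * (1 - 1 / 2) ^ (n - i) * 2 ^ n = 1 := by
      rw [show (1 - 1 / 2 : ℝ) = 1 / 2 by norm_num, ← pow_add, Nat.add_sub_cancel' hi, ← mul_pow]
      norm_num
    linear_combination (-4 * ((n : ℝ) * (1 / 2) - i) ^ 2 * n.choose i) * h2
  rw [h', h]
  ring

section Smoothing

variable {G : Type*} [AddCommMonoid G]

/-- The coefficients of `(1 - u)(1 + u)^j` are bounded by those of its expansion in
`succ_mul_one_sub_mul_one_add_pow`, and these by Cauchy–Schwarz and the binomial variance. -/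
theorem l1Norm_one_sub_mul_one_add_pow_le (u : AddMonoidAlgebra ℝ G) (hu : l1Norm u ≤ 1) (j : ℕ) :
    l1Norm ((1 - u) * (1 + u) ^ j) ≤ 2 ^ j * (2 / √(j + 1)) := by
  set S := ∑ i ∈ Finset.range (j + 2),
    ((j + 1).choose i : ℝ) * |((j + 1 : ℕ) : ℝ) - 2 * i| with hS
  have h1 : ((j : ℝ) + 1) * l1Norm ((1 - u) * (1 + u) ^ j) ≤ S := by
    have h := congrArg l1Norm (succ_mul_one_sub_mul_one_add_pow u j)
    have hl : ((j + 1 : ℕ) : AddMonoidAlgebra ℝ G) * ((1 - u) * (1 + u) ^ j)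
        = ((j : ℝ) + 1) • ((1 - u) * (1 + u) ^ j) := by
      rw [← nsmul_eq_mul, ← Nat.cast_smul_eq_nsmul ℝ]
      push_cast
      rfl
    rw [hl, l1Norm_smul, abs_of_nonneg (by positivity)] at h
    rw [h, hS]
    refine (l1Norm_sum_le _ _).trans (Finset.sum_le_sum fun i _ => ?_)
    have hr : ((j + 1).choose i : AddMonoidAlgebra ℝ G) * ((j + 1 : ℕ) - 2 * i) * u ^ i
        = (((j + 1).choose i : ℝ) * (((j + 1 : ℕ) : ℝ) - 2 * i)) • u ^ i := by
      rw [Algebra.smul_def]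
      simp only [map_mul, map_sub, map_natCast, map_ofNat]
    rw [hr, l1Norm_smul, abs_mul, Nat.abs_cast]
    exact mul_le_of_le_one_right (by positivity)
      ((l1Norm_pow_le u i).trans (pow_le_one₀ (l1Norm_nonneg _) hu))
  have h2 : S ^ 2 ≤ 2 ^ (j + 1) * (2 ^ (j + 1) * ((j : ℝ) + 1)) := by
    have hv := sum_choose_mul_sq (j + 1)
    have hc : ∑ i ∈ Finset.range (j + 2), ((j + 1).choose i : ℝ) = 2 ^ (j + 1) := by
      exact_mod_cast Nat.sum_range_choose (j + 1)
    push_cast at hv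
    rw [← hv, ← hc, hS]
    refine Finset.sum_sq_le_sum_mul_sum_of_sq_le_mul _ (fun i _ => by positivity)
      (fun i _ => by positivity) fun i _ => ?_
    rw [mul_pow, sq_abs]
    push_cast
    exact le_of_eq (by ring)
  have hj : (0 : ℝ) < j + 1 := by positivity
  have h3 : S ≤ 2 ^ (j + 1) * √(j + 1) := by
    refine abs_le_of_sq_le_sq' ?_ (by positivity) |>.2
    rw [mul_pow, Real.sq_sqrt hj.le]
    linarith
  have h4 : ((j : ℝ) + 1) * (2 ^ j * (2 / √(j + 1))) = 2 ^ (j + 1) * √(j + 1) := by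
    have := Real.mul_self_sqrt hj.le
    have h0 : √((j : ℝ) + 1) ≠ 0 := (Real.sqrt_pos.2 hj).ne'
    field_simp
    rw [Real.sq_sqrt hj.le]
    ring
  exact le_of_mul_le_mul_left (h1.trans (h3.trans h4.ge)) hj

/-- A bound for the mean of `2/√(N+1)`, where `N` is binomial with parameters `k` and `l`. It follows
by Cauchy–Schwarz from the mean of `1/(N+1)`, which the identity
`(k+1) C(k,j) = (j+1) C(k+1,j+1)` makes computable. -/
theorem sum_binomial_div_sqrt_le {l : ℝ} (hl : 0 < l) (hl1 : l ≤ 1) (k : ℕ) :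
    ∑ j ∈ Finset.range (k + 1), (l ^ j * (1 - l) ^ (k - j) * k.choose j) * (2 / √(j + 1))
      ≤ 2 / √(l * (k + 1)) := by
  have h1l : 0 ≤ 1 - l := by linarith
  have hk : (0 : ℝ) < k + 1 := by positivity
  have hw : ∀ j, 0 ≤ l ^ j * (1 - l) ^ (k - j) * k.choose j := fun j => by positivity
  have h1 : ∑ j ∈ Finset.range (k + 1), l ^ j * (1 - l) ^ (k - j) * k.choose j = 1 := by
    rw [← add_pow, add_sub_cancel, one_pow]
  have h2 : ∑ j ∈ Finset.range (k + 1),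
      (l ^ j * (1 - l) ^ (k - j) * k.choose j) * (4 / (j + 1)) ≤ 4 / (l * (k + 1)) := by
    rw [le_div_iff₀ (by positivity)]
    have hs : ∑ j ∈ Finset.range (k + 1), l ^ (j + 1) * (1 - l) ^ (k + 1 - (j + 1))
        * (k + 1).choose (j + 1) ≤ 1 := by
      have h := add_pow l (1 - l) (k + 1)
      rw [add_sub_cancel, one_pow, Finset.sum_range_succ'] at h
      have h0 : 0 ≤ l ^ 0 * (1 - l) ^ (k + 1 - 0) * (k + 1).choose 0 := by positivity
      linarith
    have : (∑ j ∈ Finset.range (k + 1),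
      (l ^ j * (1 - l) ^ (k - j) * k.choose j) * (4 / (j + 1))) * (l * (k + 1))
        = 4 * ∑ j ∈ Finset.range (k + 1), l ^ (j + 1) * (1 - l) ^ (k + 1 - (j + 1))
        * (k + 1).choose (j + 1) := by
      rw [Finset.mul_sum, Finset.sum_mul]
      refine Finset.sum_congr rfl fun j _ => ?_
      have h := congrArg (Nat.cast (R := ℝ)) (Nat.add_one_mul_choose_eq k j)
      push_cast at h
      rw [Nat.add_sub_add_right]
      have hj : (j : ℝ) + 1 ≠ 0 := by positivity
      field_simp
      linear_combination (l ^ (j + 1) * (1 - l) ^ (k - j)) * h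
    rw [this]
    linarith
  have h3 := Finset.sum_sq_le_sum_mul_sum_of_sq_le_mul (Finset.range (k + 1))
    (r := fun j : ℕ => (l ^ j * (1 - l) ^ (k - j) * k.choose j) * (2 / √((j : ℝ) + 1)))
    (f := fun j : ℕ => l ^ j * (1 - l) ^ (k - j) * k.choose j)
    (g := fun j : ℕ => (l ^ j * (1 - l) ^ (k - j) * k.choose j) * (4 / ((j : ℝ) + 1)))
    (fun j _ => hw j) (fun j _ => mul_nonneg (hw j) (by positivity)) (fun j _ => by
      rw [mul_pow, div_pow, Real.sq_sqrt (by positivity)]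
      exact le_of_eq (by ring))
  rw [h1, one_mul] at h3
  refine abs_le_of_sq_le_sq' ((h3.trans h2).trans_eq ?_) (by positivity) |>.2
  rw [div_pow, Real.sq_sqrt (by positivity)]
  norm_num

/-- Smoothing by a random walk: if `p = (l/2)(1 + u) + r` is a convex combination of the step
`(1 + u)/2` and some other step, then `(1 - u) pᵏ` is of order `k^{-1/2}` in `ℓ¹`. -/
theorem l1Norm_one_sub_mul_pow_le {u r : AddMonoidAlgebra ℝ G} (hu : l1Norm u ≤ 1) {l : ℝ}
    (hl : 0 < l) (hl1 : l ≤ 1) (hr : l1Norm r ≤ 1 - l) (k : ℕ) :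
    l1Norm ((1 - u) * ((l / 2) • (1 + u) + r) ^ k) ≤ 2 / √(l * (k + 1)) := by
  refine le_trans ?_ (sum_binomial_div_sqrt_le hl hl1 k)
  rw [add_pow, Finset.mul_sum]
  refine (l1Norm_sum_le _ _).trans (Finset.sum_le_sum fun j _ => ?_)
  have h : (1 - u) * (((l / 2) • (1 + u)) ^ j * r ^ (k - j) * (k.choose j : AddMonoidAlgebra ℝ G))
      = ((l / 2) ^ j * k.choose j) • (((1 - u) * (1 + u) ^ j) * r ^ (k - j)) := by
    rw [smul_pow]
    simp only [Algebra.smul_def, map_mul, map_natCast]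
    ring
  rw [h, l1Norm_smul, abs_of_nonneg (by positivity)]
  have h1 := l1Norm_mul_le ((1 - u) * (1 + u) ^ j) (r ^ (k - j))
  have h2 := l1Norm_one_sub_mul_one_add_pow_le u hu j
  have h3 : l1Norm (r ^ (k - j)) ≤ (1 - l) ^ (k - j) :=
    (l1Norm_pow_le _ _).trans (pow_le_pow_left₀ (l1Norm_nonneg _) hr _)
  calc (l / 2) ^ j * k.choose j * l1Norm (((1 - u) * (1 + u) ^ j) * r ^ (k - j))
      ≤ (l / 2) ^ j * k.choose j * ((2 ^ j * (2 / √(j + 1))) * (1 - l) ^ (k - j)) := by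
        refine mul_le_mul_of_nonneg_left (h1.trans ?_) (by positivity)
        exact mul_le_mul h2 h3 (l1Norm_nonneg _) (by positivity)
    _ = _ := by
        rw [div_pow]
        field_simp

end Smoothing

/-! ### `𝓘_d³ ⊆ I_d`: summation over the lazy random walk -/

theorem addSubmonoid_eq_top_of_single_mem {d : ℕ} (S : AddSubmonoid (Fin d → ℤ))
    (h1 : ∀ i, Pi.single i 1 ∈ S) (h2 : ∀ i, -Pi.single i 1 ∈ S) : S = ⊤ := by
  have hz : ∀ (i : Fin d) (k : ℤ), Pi.single i k ∈ S := by
    intro i k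
    obtain ⟨n, rfl | rfl⟩ := Int.eq_nat_or_neg k
    · have h := S.nsmul_mem (h1 i) n
      rwa [← Pi.single_smul, nsmul_one] at h
    · have h := S.nsmul_mem (h2 i) n
      rwa [← Pi.single_neg, ← Pi.single_smul, smul_neg, nsmul_one] at h
  refine eq_top_iff.2 fun n _ => ?_
  rw [← Finset.univ_sum_single n]
  exact S.sum_mem fun i _ => hz i _

theorem mono_mul_mono {d : ℕ} (m n : Fin d → ℤ) : (mono m * mono n : R d) = mono (m + n) := by
  rw [mono, mono, AddMonoidAlgebra.single_mul_single, one_mul, mono]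

theorem mono_zero {d : ℕ} : (mono 0 : R d) = 1 := rfl

/-- The augmentation ideal is generated by the `uᵢ - 1`. -/
theorem augIdeal_eq_span (d : ℕ) :
    augIdeal d = Ideal.span (Set.range fun i : Fin d => mono (Pi.single i 1) - 1) := by
  set J := Ideal.span (Set.range fun i : Fin d => mono (Pi.single i 1) - 1) with hJ
  refine le_antisymm (fun g hg => ?_) (Ideal.span_le.2 ?_)
  · have hm : ∀ n : Fin d → ℤ, mono n - 1 ∈ J := by
      let S : AddSubmonoid (Fin d → ℤ) :=
        { carrier := {n | mono n - 1 ∈ J}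
          zero_mem' := by simp [mono_zero]
          add_mem' := by
            intro a b ha hb
            have h : (mono (a + b) - 1 : R d) = mono a * (mono b - 1) + (mono a - 1) := by
              rw [← mono_mul_mono]
              ring
            rw [Set.mem_ofPred_eq, h]
            exact J.add_mem (J.mul_mem_left _ hb) ha }
      have h1 : ∀ i, Pi.single i 1 ∈ S := fun i => Ideal.subset_span ⟨i, rfl⟩
      have hS : S = ⊤ := by
        refine addSubmonoid_eq_top_of_single_mem S h1 fun i => ?_
        have h : (mono (-Pi.single i 1) - 1 : R d)
            = -mono (-Pi.single i 1) * (mono (Pi.single i 1) - 1) := by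
          rw [mul_sub, neg_mul, mono_mul_mono, neg_add_cancel, mono_zero]
          ring
        change _ ∈ J
        rw [h]
        exact J.mul_mem_left _ (h1 i)
      intro n
      have : n ∈ S := hS ▸ AddSubmonoid.mem_top n
      exact this
    have hall : ∀ g : R d, g - (evalOne d g : R d) ∈ J := by
      intro g
      induction g using AddMonoidAlgebra.induction_linear with
      | zero => simp
      | add p q hp hq =>
        have h := J.add_mem hp hq
        rw [map_add, Int.cast_add]
        convert h using 1
        ring
      | single k a =>
        have h : (AddMonoidAlgebra.single k a : R d) = (a : R d) * mono k := by
          rw [AddMonoidAlgebra.intCast_def, mono, AddMonoidAlgebra.single_mul_single, zero_add,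
            mul_one, Int.cast_id]
        rw [h, map_mul, evalOne_mono, map_intCast, mul_one, Int.cast_id, ← mul_sub_one]
        exact J.mul_mem_left _ (hm k)
    have h := hall g
    rwa [(RingHom.mem_ker).1 hg, Int.cast_zero, sub_zero] at h
  · rintro _ ⟨i, rfl⟩
    exact mono_sub_one_mem _

/-- The inclusion of `R_d` into the real group ring. -/
noncomputable def toReal {d : ℕ} : R d →+* AddMonoidAlgebra ℝ (Fin d → ℤ) :=
  AddMonoidAlgebra.mapRingHom (Fin d → ℤ) (Int.castRingHom ℝ)

theorem toReal_coeff {d : ℕ} (g : R d) (n : Fin d → ℤ) : (toReal g).coeff n = g.coeff n := by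
  simp [toReal]

theorem toReal_single {d : ℕ} (n : Fin d → ℤ) (a : ℤ) :
    toReal (AddMonoidAlgebra.single n a) = AddMonoidAlgebra.single n (a : ℝ) := by
  simp [toReal]

theorem mulW_coeff {d : ℕ} (g : R d) (a : AddMonoidAlgebra ℝ (Fin d → ℤ)) :
    mulW g (fun n => a.coeff n) = fun n => (toReal g * a).coeff n := by
  induction g using AddMonoidAlgebra.induction_linear with
  | zero => funext n; simp [mulW]
  | add p q hp hq => funext n; simp [mulW_add, hp, hq, add_mul]
  | single k a =>
    funext n
    rw [mulW_single, toReal_single, AddMonoidAlgebra.coeff_single_mul_apply, sub_eq_neg_add]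

theorem mulW_tsum {d : ℕ} (g : R d) {w : ℕ → W d} (hw : ∀ n, Summable fun k => w k n)
    (n : Fin d → ℤ) : mulW g (fun n => ∑' k, w k n) n = ∑' k, mulW g (w k) n := by
  simp only [mulW, Finsupp.sum]
  rw [Summable.tsum_finsetSum fun m _ => (hw _).mul_left _]
  simp only [tsum_mul_left]

theorem mulW_smul {d : ℕ} (g : R d) (c : ℝ) (w : W d) : mulW g (c • w) = c • mulW g w := by
  funext n
  simp only [mulW, Finsupp.sum, Pi.smul_apply, smul_eq_mul, Finset.mul_sum]
  exact Finset.sum_congr rfl fun m _ => by ring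

/-- The transition probabilities `1 - f/(4d)` of the lazy simple random walk on `ℤ^d`. -/
noncomputable def lazyWalk (d : ℕ) : AddMonoidAlgebra ℝ (Fin d → ℤ) :=
  1 - (1 / (4 * d) : ℝ) • toReal (f d)

theorem toReal_f {d : ℕ} (hd : 0 < d) : toReal (f d) = (4 * d : ℝ) • (1 - lazyWalk d) := by
  have : (d : ℝ) ≠ 0 := by positivity
  rw [lazyWalk, sub_sub_cancel, smul_smul, mul_one_div_cancel (by positivity), one_smul]

/-- The lazy walk makes the step `eᵢ` with probability `1/(4d)`. Together with an equal share of the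
probability `1/2` of the step `0` it gives the multiple of `1 + uᵢ` that smooths in direction `i`. -/
theorem exists_lazyWalk_eq {d : ℕ} (i : Fin d) :
    ∃ r : AddMonoidAlgebra ℝ (Fin d → ℤ), l1Norm r ≤ 1 - 1 / (2 * d) ∧
      lazyWalk d = (1 / (2 * d) / 2 : ℝ) • (1 + toReal (mono (Pi.single i 1))) + r := by
  classical
  have hd : (1 : ℝ) ≤ d := by exact_mod_cast i.pos
  refine ⟨(1 / 2 - 1 / (4 * d) : ℝ) • 1 + (1 / (4 * d) : ℝ) • (toReal (mono (-Pi.single i 1)) +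
    ∑ j ∈ Finset.univ.erase i,
      (toReal (mono (Pi.single j 1)) + toReal (mono (-Pi.single j 1)))), ?_, ?_⟩
  · have hm : ∀ n : Fin d → ℤ, l1Norm (toReal (mono n)) = 1 := fun n => by
      rw [mono, toReal_single, l1Norm_single, Int.cast_one, abs_one]
    have h0 : (0 : ℝ) ≤ 1 / 2 - 1 / (4 * d) := by
      rw [sub_nonneg, div_le_div_iff₀ (by positivity) (by positivity)]
      linarith
    refine (l1Norm_add_le _ _).trans ?_
    rw [l1Norm_smul, l1Norm_smul, l1Norm_one, abs_of_nonneg h0, abs_of_nonneg (by positivity)]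
    have h1 : l1Norm (toReal (mono (-Pi.single i 1)) + ∑ j ∈ Finset.univ.erase i,
        (toReal (mono (Pi.single j 1)) + toReal (mono (-Pi.single j 1)))) ≤ 1 + (d - 1) * 2 := by
      refine (l1Norm_add_le _ _).trans (add_le_add (hm _).le ((l1Norm_sum_le _ _).trans ?_))
      refine (Finset.sum_le_card_nsmul _ _ 2 fun j _ => (l1Norm_add_le _ _).trans ?_).trans ?_
      · rw [hm, hm]
        norm_num
      · rw [Finset.card_erase_of_mem (Finset.mem_univ i), Finset.card_univ, Fintype.card_fin,
          nsmul_eq_mul, Nat.cast_pred i.pos]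
    calc (1 / 2 - 1 / (4 * d) : ℝ) * 1 + 1 / (4 * d) * _
        ≤ (1 / 2 - 1 / (4 * d) : ℝ) * 1 + 1 / (4 * d) * (1 + (d - 1) * 2) := by gcongr
      _ = 1 - 1 / (2 * d) := by
        field_simp
        ring
  · have hf : toReal (f d) = (2 * d : ℝ) • 1 -
        ∑ j : Fin d, (toReal (mono (Pi.single j 1)) + toReal (mono (-Pi.single j 1))) := by
      rw [f, map_sub, map_sum, map_natCast, Algebra.smul_def, mul_one]
      simp only [map_add]
      congr 1
      push_cast
      simp only [map_ofNat]
    rw [lazyWalk, hf, ← Finset.add_sum_erase _ _ (Finset.mem_univ i)]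
    generalize toReal (mono (Pi.single i 1)) = u
    generalize toReal (mono (-Pi.single i 1)) = u'
    generalize ∑ j ∈ Finset.univ.erase i,
      (toReal (mono (Pi.single j 1)) + toReal (mono (-Pi.single j 1))) = s
    have h : (1 / (4 * d) : ℝ) * (2 * d) = 1 / 2 := by
      field_simp
      norm_num
    rw [smul_sub, smul_smul, h, show (1 / (2 * d) / 2 : ℝ) = 1 / (4 * d) by ring]
    module

theorem l1Norm_lazyWalk_le {d : ℕ} (hd : 0 < d) : l1Norm (lazyWalk d) ≤ 1 := by
  obtain ⟨r, hr, h⟩ := exists_lazyWalk_eq (⟨0, hd⟩ : Fin d)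
  rw [h]
  refine (l1Norm_add_le _ _).trans ?_
  have h2 := l1Norm_add_le (1 : AddMonoidAlgebra ℝ (Fin d → ℤ))
    (toReal (mono (Pi.single ⟨0, hd⟩ 1)))
  rw [l1Norm_one, mono, toReal_single, l1Norm_single, Int.cast_one, abs_one] at h2
  rw [l1Norm_smul, abs_of_nonneg (by positivity), mono, toReal_single, Int.cast_one]
  have h3 : (1 / (2 * d) / 2 : ℝ) * _ ≤ _ := mul_le_mul_of_nonneg_left h2 (by positivity)
  linarith

/-- Each factor from the augmentation ideal gains `k^{-1/2}` in the `ℓ¹`-norm of `g pᵏ`: the `k`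
steps are distributed evenly among the factors. -/
theorem exists_l1Norm_mul_lazyWalk_pow_le {d : ℕ} (hd : 0 < d) (j : ℕ) :
    ∀ g ∈ augIdeal d ^ j, ∃ C : ℝ, ∀ k : ℕ,
      l1Norm (toReal g * lazyWalk d ^ k) ≤ C * ((k : ℝ) + 1) ^ (-(j / 2 : ℝ)) := by
  have hp : ∀ k, l1Norm (lazyWalk d ^ k) ≤ 1 := fun k =>
    (l1Norm_pow_le _ _).trans (pow_le_one₀ (l1Norm_nonneg _) (l1Norm_lazyWalk_le hd))
  have hone : ∀ g ∈ augIdeal d, ∃ C : ℝ, ∀ k : ℕ,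
      l1Norm (toReal g * lazyWalk d ^ k) ≤ C * ((k : ℝ) + 1) ^ (-(1 / 2 : ℝ)) := by
    intro g hg
    rw [augIdeal_eq_span] at hg
    induction hg using Submodule.span_induction with
    | mem x hx =>
      obtain ⟨i, rfl⟩ := hx
      obtain ⟨r, hr, h⟩ := exists_lazyWalk_eq i
      refine ⟨2 / √(1 / (2 * d)), fun k => ?_⟩
      have hu : l1Norm (toReal (mono (Pi.single i 1) : R d)) ≤ 1 := by
        rw [mono, toReal_single, l1Norm_single, Int.cast_one, abs_one]
      have hd1 : (1 : ℝ) ≤ d := by exact_mod_cast hd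
      have hb := l1Norm_one_sub_mul_pow_le hu (l := 1 / (2 * d)) (by positivity)
        (by rw [div_le_one (by positivity)]; linarith) hr k
      rw [← h] at hb
      have hneg : toReal (mono (Pi.single i 1) - 1 : R d) * lazyWalk d ^ k
          = (-1 : ℝ) • ((1 - toReal (mono (Pi.single i 1))) * lazyWalk d ^ k) := by
        rw [map_sub, map_one, neg_one_smul]
        ring
      rw [hneg, l1Norm_smul, abs_neg, abs_one, one_mul]
      refine hb.trans_eq ?_
      rw [Real.sqrt_mul (by positivity), Real.rpow_neg (by positivity), ← Real.sqrt_eq_rpow,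
        div_mul_eq_div_div]
      rfl
    | zero => exact ⟨0, fun k => by simp [l1Norm_zero]⟩
    | add x y _ _ hx hy =>
      obtain ⟨C, hC⟩ := hx
      obtain ⟨D, hD⟩ := hy
      refine ⟨C + D, fun k => ?_⟩
      rw [map_add, add_mul, add_mul]
      exact (l1Norm_add_le _ _).trans (add_le_add (hC k) (hD k))
    | smul a x _ hx =>
      obtain ⟨C, hC⟩ := hx
      refine ⟨l1Norm (toReal a) * C, fun k => ?_⟩
      rw [smul_eq_mul, map_mul, mul_assoc, mul_assoc]
      exact (l1Norm_mul_le _ _).trans (mul_le_mul_of_nonneg_left (hC k) (l1Norm_nonneg _))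
  induction j with
  | zero =>
    intro g _
    refine ⟨l1Norm (toReal g), fun k => ?_⟩
    simp only [Nat.cast_zero, zero_div, neg_zero, Real.rpow_zero]
    exact (l1Norm_mul_le _ _).trans (mul_le_mul_of_nonneg_left (hp k) (l1Norm_nonneg _))
  | succ j ih =>
    intro g hg
    rw [pow_succ] at hg
    induction hg using Submodule.mul_induction_on' with
    | mem_mul_mem x hx y hy =>
      obtain ⟨C, hC⟩ := ih x hx
      obtain ⟨D, hD⟩ := hone y hy
      have hC0 : 0 ≤ C := by
        have := (l1Norm_nonneg _).trans (hC 0)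
        simpa using this
      have hD0 : 0 ≤ D := by
        have := (l1Norm_nonneg _).trans (hD 0)
        simpa using this
      refine ⟨C * D * (1 / 2) ^ (-((j + 1 : ℕ) / 2 : ℝ)), fun k => ?_⟩
      have hsplit : k = k / 2 + (k - k / 2) := by omega
      have h1 : ((k : ℝ) + 1) / 2 ≤ (k / 2 : ℕ) + 1 := by
        have : k ≤ 2 * (k / 2) + 1 := by omega
        have : (k : ℝ) ≤ 2 * (k / 2 : ℕ) + 1 := by exact_mod_cast this
        linarith
      have h2 : ((k : ℝ) + 1) / 2 ≤ (k - k / 2 : ℕ) + 1 := by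
        have : k ≤ 2 * (k - k / 2) + 1 := by omega
        have : (k : ℝ) ≤ 2 * (k - k / 2 : ℕ) + 1 := by exact_mod_cast this
        linarith
      have hk : (0 : ℝ) < ((k : ℝ) + 1) / 2 := by positivity
      have e : toReal (x * y) * lazyWalk d ^ k
          = (toReal x * lazyWalk d ^ (k / 2)) * (toReal y * lazyWalk d ^ (k - k / 2)) := by
        conv_lhs => rw [hsplit, pow_add, map_mul]
        ring
      rw [e]
      refine (l1Norm_mul_le _ _).trans ((mul_le_mul (hC _) (hD _) (l1Norm_nonneg _)
        (by positivity)).trans ?_)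
      have h3 : (((k / 2 : ℕ) : ℝ) + 1) ^ (-(j / 2 : ℝ)) ≤ (((k : ℝ) + 1) / 2) ^ (-(j / 2 : ℝ)) :=
        Real.rpow_le_rpow_of_nonpos hk h1 (by rw [neg_nonpos]; positivity)
      have h4 : (((k - k / 2 : ℕ) : ℝ) + 1) ^ (-(1 / 2 : ℝ))
          ≤ (((k : ℝ) + 1) / 2) ^ (-(1 / 2 : ℝ)) :=
        Real.rpow_le_rpow_of_nonpos hk h2 (by norm_num)
      have h5 : (((k : ℝ) + 1) / 2) ^ (-(j / 2 : ℝ)) * (((k : ℝ) + 1) / 2) ^ (-(1 / 2 : ℝ))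
          = (1 / 2) ^ (-((j + 1 : ℕ) / 2 : ℝ)) * ((k : ℝ) + 1) ^ (-((j + 1 : ℕ) / 2 : ℝ)) := by
        rw [← Real.rpow_add hk, ← Real.mul_rpow (by norm_num) (by positivity)]
        congr 1
        · ring
        · push_cast
          ring
      calc _ = C * D * ((((k / 2 : ℕ) : ℝ) + 1) ^ (-(j / 2 : ℝ))
              * (((k - k / 2 : ℕ) : ℝ) + 1) ^ (-(1 / 2 : ℝ))) := by ring
        _ ≤ C * D * ((((k : ℝ) + 1) / 2) ^ (-(j / 2 : ℝ))
              * (((k : ℝ) + 1) / 2) ^ (-(1 / 2 : ℝ))) := by gcongr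
        _ = _ := by rw [h5]; ring
    | add x _ y _ hx hy =>
      obtain ⟨C, hC⟩ := hx
      obtain ⟨D, hD⟩ := hy
      refine ⟨C + D, fun k => ?_⟩
      rw [map_add, add_mul, add_mul]
      exact (l1Norm_add_le _ _).trans (add_le_add (hC k) (hD k))

theorem summable_abs_tsum {G : Type*} {b : ℕ → G → ℝ} {N : ℕ → ℝ} (hN : Summable N)
    (hb : ∀ (s : Finset G) k, ∑ n ∈ s, |b k n| ≤ N k) : Summable fun n => |∑' k, b k n| := by
  have habs : ∀ n, Summable fun k => |b k n| := fun n =>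
    Summable.of_nonneg_of_le (fun _ => abs_nonneg _) (fun k => by simpa using hb {n} k) hN
  refine summable_of_sum_le (c := ∑' k, N k) (fun _ => abs_nonneg _) fun s => ?_
  calc ∑ n ∈ s, |∑' k, b k n| ≤ ∑ n ∈ s, ∑' k, |b k n| :=
        Finset.sum_le_sum fun n _ => norm_tsum_le_tsum_norm (f := fun k => b k n) (habs n)
    _ = ∑' k, ∑ n ∈ s, |b k n| := (Summable.tsum_finsetSum fun n _ => habs n).symm
    _ ≤ ∑' k, N k := Summable.tsum_le_tsum (hb s) (summable_sum fun n _ => habs n) hN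

theorem mem_ellOne_iff {d : ℕ} {w : W d} : w ∈ ellOne d ↔ Summable fun n => |w n| := by
  rw [ellOne, Set.mem_ofPred_eq, memℓp_gen_iff (by simp)]
  simp

/-- Every `g ∈ 𝓘_d³` is of the form `f · h` with `h ∈ ℓ¹`, namely `h = (4d)⁻¹ ∑ₖ g pᵏ` for the lazy
walk `p`. -/
theorem exists_mulW_f_eq_of_mem {d : ℕ} (hd : 0 < d) {g : R d} (hg : g ∈ augIdeal d ^ 3) :
    ∃ h ∈ ellOne d, mulW (f d) h = fun n => (g.coeff n : ℝ) := by
  obtain ⟨C, hC⟩ := exists_l1Norm_mul_lazyWalk_pow_le hd 3 g hg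
  obtain ⟨a, ha⟩ : ∃ a : ℕ → AddMonoidAlgebra ℝ (Fin d → ℤ),
      ∀ k, a k = toReal g * lazyWalk d ^ k := ⟨_, fun _ => rfl⟩
  simp only [← ha] at hC
  have hN : Summable fun k => l1Norm (a k) := by
    refine Summable.of_nonneg_of_le (fun k => l1Norm_nonneg _) hC (Summable.mul_left _ ?_)
    have h := (summable_nat_add_iff 1).2
      (Real.summable_nat_rpow (p := -((3 : ℕ) / 2 : ℝ)).2 (by norm_num))
    exact_mod_cast h
  have hd0 : (d : ℝ) ≠ 0 := by positivity
  have hsn : ∀ s : Finset (Fin d → ℤ), ∀ k, ∑ n ∈ s, |(a k).coeff n| ≤ l1Norm (a k) :=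
    fun s k => sum_abs_coeff_le_l1Norm _ _
  have hsum : ∀ n, Summable fun k => (a k).coeff n := fun n => Summable.of_abs <|
    Summable.of_nonneg_of_le (fun _ => abs_nonneg _) (fun k => by simpa using hsn {n} k) hN
  refine ⟨(1 / (4 * d) : ℝ) • fun n => ∑' k, (a k).coeff n, ?_, ?_⟩
  · rw [mem_ellOne_iff]
    simp only [Pi.smul_apply, smul_eq_mul, abs_mul]
    exact (summable_abs_tsum hN hsn).mul_left _
  · rw [mulW_smul]
    funext n
    have hk : ∀ k, mulW (f d) (fun n => (a k).coeff n) n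
        = (4 * d : ℝ) * ((a k).coeff n - (a (k + 1)).coeff n) := by
      intro k
      have e : toReal (f d) * a k = (4 * d : ℝ) • (a k - a (k + 1)) := by
        rw [toReal_f hd, ha, ha, smul_mul_assoc]
        congr 1
        ring
      rw [mulW_coeff, e]
      simp
    rw [Pi.smul_apply, mulW_tsum (f d) hsum]
    simp only [hk]
    rw [tsum_mul_left, ((hsum n).tsum_sub ((summable_nat_add_iff 1).2 (hsum n))),
      (hsum n).tsum_eq_zero_add, add_sub_cancel_right, smul_eq_mul, ← mul_assoc,
      one_div_mul_cancel (by positivity), one_mul, ha]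
    simp [toReal_coeff]

/-! ### Characters and Fourier transforms -/

/-- The unitary character `n ↦ ∏ᵢ zᵢ ^ nᵢ` of `ℤ^d`, as a complex-valued function. -/
noncomputable def charAt {d : ℕ} (z : Fin d → Circle) (n : Fin d → ℤ) : ℂ :=
  ((∏ i, z i ^ n i : Circle) : ℂ)

theorem charAt_add {d : ℕ} (z : Fin d → Circle) (m n : Fin d → ℤ) :
    charAt z (m + n) = charAt z m * charAt z n := by
  simp only [charAt, Pi.add_apply, zpow_add, Finset.prod_mul_distrib, Circle.coe_mul]

theorem charAt_zero {d : ℕ} (z : Fin d → Circle) : charAt z 0 = 1 := by simp [charAt]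

theorem norm_charAt {d : ℕ} (z : Fin d → Circle) (n : Fin d → ℤ) : ‖charAt z n‖ = 1 :=
  Circle.norm_coe _

theorem charAt_single {d : ℕ} (z : Fin d → Circle) (i : Fin d) :
    charAt z (Pi.single i 1) = z i := by
  rw [charAt, Finset.prod_eq_single i]
  · simp
  · intro j _ hj
    simp [hj]
  · simp

theorem charAt_neg {d : ℕ} (z : Fin d → Circle) (n : Fin d → ℤ) :
    charAt z (-n) = (starRingEnd ℂ) (charAt z n) := by
  simp only [charAt, Pi.neg_apply, zpow_neg, Finset.prod_inv_distrib, Circle.coe_inv_eq_conj]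

theorem continuous_charAt {d : ℕ} (n : Fin d → ℤ) :
    Continuous fun z : Fin d → Circle => charAt z n := by
  unfold charAt
  fun_prop

/-- Evaluation of Laurent polynomials at a point `z` of the torus, as a ring homomorphism. -/
noncomputable def evalAt {d : ℕ} (z : Fin d → Circle) : R d →+* ℂ :=
  (AddMonoidAlgebra.lift ℤ ℂ (Fin d → ℤ)
    { toFun := fun n => charAt z n.toAdd
      map_one' := charAt_zero z
      map_mul' := fun m n => charAt_add z m.toAdd n.toAdd } : R d →ₐ[ℤ] ℂ)

theorem evalAt_eq_sum {d : ℕ} (z : Fin d → Circle) (g : R d) :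
    evalAt z g = g.coeff.sum fun n a => (a : ℂ) * charAt z n := by
  simp [evalAt, AddMonoidAlgebra.lift_apply]

theorem evalAt_single {d : ℕ} (z : Fin d → Circle) (n : Fin d → ℤ) (a : ℤ) :
    evalAt z (AddMonoidAlgebra.single n a) = a * charAt z n := by
  simp [evalAt]

theorem evalAt_mono {d : ℕ} (z : Fin d → Circle) (n : Fin d → ℤ) :
    evalAt z (mono n) = charAt z n := by
  rw [mono, evalAt_single, Int.cast_one, one_mul]

theorem evalAt_one_eq {d : ℕ} (g : R d) : evalAt (1 : Fin d → Circle) g = (evalOne d g : ℂ) := by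
  induction g using AddMonoidAlgebra.induction_linear with
  | zero => simp
  | add p q hp hq => simp [hp, hq]
  | single k a => simp [evalAt_single, evalOne, charAt]

/-- The Euclidean distance between `z` and `(1, …, 1)`, whose square is the value of `f` at `z`. -/
noncomputable def gap {d : ℕ} (z : Fin d → Circle) : ℝ := √(∑ i, ‖(z i : ℂ) - 1‖ ^ 2)

theorem gap_nonneg {d : ℕ} (z : Fin d → Circle) : 0 ≤ gap z := Real.sqrt_nonneg _

theorem gap_sq {d : ℕ} (z : Fin d → Circle) : gap z ^ 2 = ∑ i, ‖(z i : ℂ) - 1‖ ^ 2 :=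
  Real.sq_sqrt (Finset.sum_nonneg fun _ _ => by positivity)

theorem norm_sub_one_le_gap {d : ℕ} (z : Fin d → Circle) (i : Fin d) :
    ‖(z i : ℂ) - 1‖ ≤ gap z :=
  Real.le_sqrt_of_sq_le (Finset.single_le_sum (f := fun i => ‖(z i : ℂ) - 1‖ ^ 2)
    (fun _ _ => by positivity) (Finset.mem_univ i))

theorem continuous_gap {d : ℕ} : Continuous (gap : (Fin d → Circle) → ℝ) := by
  unfold gap
  fun_prop

theorem gap_one {d : ℕ} : gap (1 : Fin d → Circle) = 0 := by simp [gap]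

theorem evalAt_f {d : ℕ} (z : Fin d → Circle) : evalAt z (f d) = (gap z : ℂ) ^ 2 := by
  rw [f_eq, map_sum, ← Complex.ofReal_pow, gap_sq, Complex.ofReal_sum]
  refine Finset.sum_congr rfl fun i _ => ?_
  rw [map_mul, map_sub, map_sub, evalAt_mono, evalAt_mono, charAt_neg, charAt_single, map_one,
    Complex.ofReal_pow, ← Complex.mul_conj', map_sub, map_one]

/-- An element of `𝓘_d^j` vanishes at `(1, …, 1)` to order `j`. -/
theorem exists_norm_evalAt_le {d : ℕ} (j : ℕ) :
    ∀ g ∈ augIdeal d ^ j, ∃ C : ℝ, 0 ≤ C ∧ ∀ z, ‖evalAt z g‖ ≤ C * gap z ^ j := by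
  have hbd : ∀ (g : R d) z, ‖evalAt z g‖ ≤ l1Norm (toReal g) := by
    intro g z
    have hs : (toReal g).coeff.support ⊆ g.coeff.support := by
      intro n hn
      rw [Finsupp.mem_support_iff, toReal_coeff] at hn
      rw [Finsupp.mem_support_iff]
      exact_mod_cast hn
    rw [evalAt_eq_sum, l1Norm_eq_sum hs]
    refine (norm_sum_le _ _).trans (Finset.sum_le_sum fun n _ => ?_)
    rw [norm_mul, norm_charAt, mul_one, toReal_coeff, Complex.norm_intCast]
  have hadd : ∀ (j : ℕ) (x y : R d),
      (∃ C : ℝ, 0 ≤ C ∧ ∀ z, ‖evalAt z x‖ ≤ C * gap z ^ j) →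
      (∃ C : ℝ, 0 ≤ C ∧ ∀ z, ‖evalAt z y‖ ≤ C * gap z ^ j) →
      ∃ C : ℝ, 0 ≤ C ∧ ∀ z, ‖evalAt z (x + y)‖ ≤ C * gap z ^ j := by
    rintro j x y ⟨C, hC0, hC⟩ ⟨D, hD0, hD⟩
    refine ⟨C + D, by positivity, fun z => ?_⟩
    rw [map_add, add_mul]
    exact (norm_add_le _ _).trans (add_le_add (hC z) (hD z))
  have hone : ∀ g ∈ augIdeal d, ∃ C : ℝ, 0 ≤ C ∧ ∀ z, ‖evalAt z g‖ ≤ C * gap z ^ 1 := by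
    intro g hg
    rw [augIdeal_eq_span] at hg
    induction hg using Submodule.span_induction with
    | mem x hx =>
      obtain ⟨i, rfl⟩ := hx
      refine ⟨1, zero_le_one, fun z => ?_⟩
      rw [map_sub, evalAt_mono, charAt_single, map_one, one_mul, pow_one]
      exact norm_sub_one_le_gap z i
    | zero => exact ⟨0, le_rfl, fun z => by simp⟩
    | add x y _ _ hx hy => exact hadd 1 x y hx hy
    | smul a x _ hx =>
      obtain ⟨C, hC0, hC⟩ := hx
      refine ⟨l1Norm (toReal a) * C, mul_nonneg (l1Norm_nonneg _) hC0, fun z => ?_⟩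
      rw [smul_eq_mul, map_mul, norm_mul, mul_assoc]
      exact mul_le_mul (hbd a z) (hC z) (norm_nonneg _) (l1Norm_nonneg _)
  induction j with
  | zero => exact fun g _ => ⟨l1Norm (toReal g), l1Norm_nonneg _, fun z => by simpa using hbd g z⟩
  | succ j ih =>
    intro g hg
    rw [pow_succ] at hg
    induction hg using Submodule.mul_induction_on' with
    | mem_mul_mem x hx y hy =>
      obtain ⟨C, hC0, hC⟩ := ih x hx
      obtain ⟨D, hD0, hD⟩ := hone y hy
      refine ⟨C * D, mul_nonneg hC0 hD0, fun z => ?_⟩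
      rw [map_mul, norm_mul, pow_succ]
      refine (mul_le_mul (hC z) (hD z) (norm_nonneg _)
        (mul_nonneg hC0 (pow_nonneg (gap_nonneg z) j))).trans_eq (by ring)
    | add x _ y _ hx hy => exact hadd _ x y hx hy

/-- Multiplication by `g` turns into multiplication by `ĝ(z)` under the Fourier transform. -/
theorem hasSum_mulW {d : ℕ} (z : Fin d → Circle) (g : R d) {w : W d} {S : ℂ}
    (hS : HasSum (fun n => (w n : ℂ) * charAt z n) S) :
    HasSum (fun n => (mulW g w n : ℂ) * charAt z n) (evalAt z g * S) := by
  induction g using AddMonoidAlgebra.induction_linear with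
  | zero => simp [mulW, hasSum_zero]
  | add p q hp hq =>
    have e : ∀ n, (mulW (p + q) w n : ℂ) * charAt z n
        = (mulW p w n : ℂ) * charAt z n + (mulW q w n : ℂ) * charAt z n := fun n => by
      rw [mulW_add, Pi.add_apply, Complex.ofReal_add, add_mul]
    simp only [e, map_add, add_mul]
    exact hp.add hq
  | single k a =>
    have e : ∀ n, (mulW (AddMonoidAlgebra.single k a) w n : ℂ) * charAt z n
        = (a : ℂ) * charAt z k * ((w (n - k) : ℂ) * charAt z (n - k)) := by
      intro n
      conv_lhs => rw [← add_sub_cancel k n, charAt_add, mulW_single]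
      simp only [add_sub_cancel]
      push_cast
      ring
    simp only [e, evalAt_single]
    exact ((Equiv.subRight k).hasSum_iff.2 hS).mul_left _

theorem hasSum_coeff {d : ℕ} (z : Fin d → Circle) (g : R d) :
    HasSum (fun n => ((g.coeff n : ℝ) : ℂ) * charAt z n) (evalAt z g) := by
  rw [evalAt_eq_sum]
  have h : HasSum (fun n => ((g.coeff n : ℝ) : ℂ) * charAt z n)
      (∑ n ∈ g.coeff.support, ((g.coeff n : ℝ) : ℂ) * charAt z n) :=
    hasSum_sum_of_ne_finset_zero fun n hn => by simp [Finsupp.notMem_support_iff.1 hn]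
  simpa [Finsupp.sum] using h

theorem summable_mul_charAt {d : ℕ} {h : W d} (hh : h ∈ ellOne d) (z : Fin d → Circle) :
    Summable fun n => (h n : ℂ) * charAt z n := by
  refine Summable.of_norm ?_
  simpa [norm_charAt] using mem_ellOne_iff.1 hh

/-- The Fourier transform of the equation `f · h = g`. -/
theorem evalAt_eq_of_mulW_f_eq {d : ℕ} {g : R d} {h : W d} (hh : h ∈ ellOne d)
    (hg : mulW (f d) h = fun n => (g.coeff n : ℝ)) (z : Fin d → Circle) :
    evalAt z g = (gap z : ℂ) ^ 2 * ∑' n, (h n : ℂ) * charAt z n := by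
  have h1 := hasSum_mulW z (f d) (summable_mul_charAt hh z).hasSum
  rw [hg, evalAt_f] at h1
  exact (hasSum_coeff z g).unique h1

/-! ### The integrals that define the fundamental solution -/

section Integrals

open MeasureTheory

/-- The point `(e^{2πi t₁}, …, e^{2πi t_d})`. -/
noncomputable def torusPoint {d : ℕ} (t : UnitAddTorus (Fin d)) : Fin d → Circle :=
  fun i => AddCircle.toCircle (t i)

theorem continuous_torusPoint {d : ℕ} :
    Continuous (torusPoint : UnitAddTorus (Fin d) → Fin d → Circle) :=
  continuous_pi fun i => AddCircle.continuous_toCircle.comp (continuous_apply i)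

theorem mFourier_eq_charAt {d : ℕ} (n : Fin d → ℤ) (t : UnitAddTorus (Fin d)) :
    UnitAddTorus.mFourier n t = charAt (torusPoint t) n := by
  have h : charAt (torusPoint t) n = ∏ i, ((torusPoint t i ^ n i : Circle) : ℂ) :=
    map_prod Circle.coeHom (fun i => torusPoint t i ^ n i) Finset.univ
  rw [h]
  simp [UnitAddTorus.mFourier, torusPoint, fourier_apply, AddCircle.toCircle_zsmul]

theorem F_eq_gap_sq {d : ℕ} (t : UnitAddTorus (Fin d)) :
    F d t = (gap (torusPoint t) : ℂ) ^ 2 := by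
  rw [← evalAt_f, evalAt_eq_sum, F]
  simp only [mFourier_eq_charAt]

instance isProbabilityMeasure_haarTorus (d : ℕ) : IsProbabilityMeasure (haarTorus d) := by
  unfold haarTorus
  infer_instance

theorem volume_unitAddCircle :
    (volume : Measure UnitAddCircle) = AddCircle.haarAddCircle := by
  rw [AddCircle.volume_eq_smul_haarAddCircle, ENNReal.ofReal_one, one_smul]

theorem norm_toCircle_sub_one (x : ℝ) :
    ‖(AddCircle.toCircle (x : UnitAddCircle) : ℂ) - 1‖ = 2 * |Real.sin (Real.pi * x)| := by
  have h := Complex.norm_exp_I_mul_ofReal_sub_one (2 * Real.pi * x)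
  rw [AddCircle.toCircle_apply_mk, Circle.coe_exp, div_one, mul_comm _ Complex.I, h, norm_mul,
    Real.norm_ofNat, Real.norm_eq_abs]
  congr 3
  ring

/-- The function `|e^{2πi t} - 1|^{-a}` is integrable for `a < 1`, as `|e^{2πi t} - 1| ≥ 4|t|` for
`|t| ≤ 1/2`. -/
theorem integrable_norm_toCircle_sub_one_rpow {a : ℝ} (h0 : 0 ≤ a) (h1 : a < 1) :
    Integrable (fun t : UnitAddCircle => ‖(AddCircle.toCircle t : ℂ) - 1‖ ^ (-a))
      AddCircle.haarAddCircle := by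
  have hmeas : Measurable fun t : UnitAddCircle => ‖(AddCircle.toCircle t : ℂ) - 1‖ ^ (-a) := by
    have hc : Continuous fun t : UnitAddCircle => ‖(AddCircle.toCircle t : ℂ) - 1‖ :=
      ((continuous_subtype_val.comp AddCircle.continuous_toCircle).sub continuous_const).norm
    exact hc.measurable.pow_const _
  rw [← volume_unitAddCircle,
    ← (AddCircle.measurePreserving_mk 1 (-(1 / 2))).integrable_comp hmeas.aestronglyMeasurable]
  have hpos : IntervalIntegrable (fun x : ℝ => |x| ^ (-a)) volume 0 (1 / 2) := by
    refine (intervalIntegral.intervalIntegrable_rpow' (r := -a) (by linarith)).congr fun x hx => ?_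
    rw [Set.uIoc_of_le (by norm_num)] at hx
    simp only [abs_of_pos hx.1]
  have hneg : IntervalIntegrable (fun x : ℝ => |x| ^ (-a)) volume (-(1 / 2)) 0 := by
    have h := (IntervalIntegrable.iff_comp_neg (by simp)).1 hpos
    simpa only [abs_neg, neg_zero] using h.symm
  have hI := (intervalIntegrable_iff_integrableOn_Ioc_of_le (by norm_num)).1 (hneg.trans hpos)
  have hI' : Integrable (fun x : ℝ => (4 : ℝ) ^ (-a) * |x| ^ (-a))
      (volume.restrict (Set.Ioc (-(1 / 2) : ℝ) (-(1 / 2) + 1))) := by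
    rw [show (-(1 / 2) + 1 : ℝ) = 1 / 2 by norm_num]
    exact hI.const_mul _
  refine hI'.mono' (hmeas.comp AddCircle.measurable_mk').aestronglyMeasurable ?_
  refine (ae_restrict_mem measurableSet_Ioc).mono fun x hx => ?_
  have hx' : |x| ≤ 1 / 2 := abs_le.2 ⟨hx.1.le, by linarith [hx.2]⟩
  rw [Function.comp_apply, Real.norm_of_nonneg (by positivity), norm_toCircle_sub_one,
    ← Real.mul_rpow (by norm_num) (abs_nonneg x)]
  rcases eq_or_ne x 0 with rfl | hx0
  · simp
  · refine Real.rpow_le_rpow_of_nonpos (by positivity) ?_ (by linarith)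
    have h := Real.mul_abs_le_abs_sin (x := Real.pi * x) (by
      rw [abs_mul, abs_of_pos Real.pi_pos]
      nlinarith [Real.pi_pos])
    rw [abs_mul, abs_of_pos Real.pi_pos] at h
    have e : 2 / Real.pi * (Real.pi * |x|) = 2 * |x| := by
      field_simp
    linarith

theorem integral_mFourier {d : ℕ} (n : Fin d → ℤ) :
    ∫ t, UnitAddTorus.mFourier n t ∂(haarTorus d) = if n = 0 then 1 else 0 := by
  split_ifs with h
  · rw [h, UnitAddTorus.mFourier_zero]
    simp
  · obtain ⟨i, hi⟩ := Function.ne_iff.1 h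
    rw [UnitAddTorus.mFourier, ContinuousMap.coe_mk, haarTorus,
      integral_fintype_prod_eq_prod (fun i (x : UnitAddCircle) => fourier (n i) x)]
    refine Finset.prod_eq_zero (Finset.mem_univ i) ?_
    exact integral_eq_zero_of_add_right_eq_neg (fourier_add_half_inv_index hi zero_lt_one)

theorem ae_toCircle_ne_one (d : ℕ) :
    ∀ᵐ t ∂(haarTorus d), ∀ i, (AddCircle.toCircle (t i) : ℂ) - 1 ≠ 0 := by
  have h1 : ∀ᵐ x ∂(AddCircle.haarAddCircle : Measure UnitAddCircle), x ≠ 0 := by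
    have hc : ((QuotientAddGroup.mk : ℝ → UnitAddCircle) ⁻¹' {0}).Countable := by
      refine (Set.countable_range fun k : ℤ => (k : ℝ)).mono fun x hx => ?_
      obtain ⟨k, hk⟩ := (AddCircle.coe_eq_zero_iff (1 : ℝ)).1 hx
      exact ⟨k, by simpa using hk⟩
    have h := (AddCircle.measurePreserving_mk 1 0).measure_preimage
      (measurableSet_singleton (0 : UnitAddCircle)).nullMeasurableSet
    rw [hc.measure_zero, volume_unitAddCircle] at h
    exact compl_mem_ae_iff.2 h.symm
  refine ae_all_iff.2 fun i => ?_
  have h2 := (measurePreserving_eval (fun _ : Fin d => (AddCircle.haarAddCircle :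
    Measure UnitAddCircle)) i).quasiMeasurePreserving.ae h1
  refine h2.mono fun t ht h => ht ?_
  rw [sub_eq_zero, ← Circle.coe_one, Circle.coe_inj, ← AddCircle.toCircle_zero] at h
  exact AddCircle.injective_toCircle one_ne_zero h

/-- The inequality of the arithmetic and geometric means, which bounds `1/F` by a product of
functions of a single variable. -/
theorem prod_norm_rpow_le_gap {d : ℕ} (hd : 0 < d) (z : Fin d → Circle) :
    ∏ i, ‖(z i : ℂ) - 1‖ ^ (1 / d : ℝ) ≤ gap z := by
  have hd1 : (1 : ℝ) ≤ d := by exact_mod_cast hd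
  refine abs_le_of_sq_le_sq' ?_ (gap_nonneg z) |>.2
  have h := Real.geom_mean_le_arith_mean_weighted Finset.univ (fun _ : Fin d => (1 / d : ℝ))
    (fun i => ‖(z i : ℂ) - 1‖ ^ 2) (fun _ _ => by positivity) (by
      rw [Finset.sum_const, Finset.card_univ, Fintype.card_fin, nsmul_eq_mul]
      exact mul_one_div_cancel (by positivity)) (fun _ _ => by positivity)
  rw [← Finset.mul_sum, ← gap_sq] at h
  calc (∏ i, ‖(z i : ℂ) - 1‖ ^ (1 / d : ℝ)) ^ 2
      = ∏ i, (‖(z i : ℂ) - 1‖ ^ 2) ^ (1 / d : ℝ) := by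
        rw [← Finset.prod_pow]
        refine Finset.prod_congr rfl fun i _ => ?_
        rw [← Real.rpow_natCast, ← Real.rpow_natCast, ← Real.rpow_mul (norm_nonneg _),
          ← Real.rpow_mul (norm_nonneg _), mul_comm]
    _ ≤ 1 / d * gap z ^ 2 := h
    _ ≤ gap z ^ 2 := mul_le_of_le_one_left (by positivity) (by
        rw [div_le_one (by positivity)]
        exact hd1)

theorem continuous_gap_torusPoint {d : ℕ} :
    Continuous fun t : UnitAddTorus (Fin d) => gap (torusPoint t) :=
  continuous_gap.comp continuous_torusPoint

/-- The integrands in the definition of the fundamental solution are integrable: they are bounded by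
multiples of `∏ⱼ |e^{2πi tⱼ} - 1|^{-a}` with `a = 1/2` for `d = 2` and `a = 2/d` for `d ≥ 3`. -/
theorem integrable_mFourier_div_F {d : ℕ} (hd : 2 ≤ d) (n : Fin d → ℤ) :
    Integrable (fun t => (UnitAddTorus.mFourier n t - if d = 2 then 1 else 0) / F d t)
      (haarTorus d) := by
  have hdpos : 0 < d := by omega
  have hmeas : AEStronglyMeasurable
      (fun t => (UnitAddTorus.mFourier n t - if d = 2 then 1 else 0) / F d t) (haarTorus d) := by
    have hF : Continuous (F d) := by
      rw [funext F_eq_gap_sq]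
      exact (Complex.continuous_ofReal.comp continuous_gap_torusPoint).pow 2
    exact ((((UnitAddTorus.mFourier n).continuous.sub continuous_const).measurable).div
      hF.measurable).aestronglyMeasurable
  have key : ∃ a C : ℝ, 0 ≤ a ∧ a < 1 ∧ ∀ z : Fin d → Circle, (∀ i, (z i : ℂ) - 1 ≠ 0) →
      ‖charAt z n - if d = 2 then 1 else 0‖ / gap z ^ 2 ≤ C * ∏ i, ‖(z i : ℂ) - 1‖ ^ (-a) := by
    have hz : ∀ z : Fin d → Circle, (∀ i, (z i : ℂ) - 1 ≠ 0) →
        0 < ∏ i, ‖(z i : ℂ) - 1‖ ^ (1 / d : ℝ) := fun z hz =>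
      Finset.prod_pos fun i _ => Real.rpow_pos_of_pos (norm_pos_iff.2 (hz i)) _
    rcases eq_or_ne d 2 with h2 | h2
    -- For `d = 2` the numerator vanishes to first order, and half of the singularity is left.
    · obtain ⟨C, hC0, hC⟩ := exists_norm_evalAt_le (d := d) 1 (mono n - 1)
        (by rw [pow_one]; exact mono_sub_one_mem n)
      refine ⟨1 / d, C, by positivity, ?_, fun z hz0 => ?_⟩
      · rw [h2]
        norm_num
      · have hP := hz z hz0
        have hg := prod_norm_rpow_le_gap hdpos z
        have hgap := hP.trans_le hg
        have hb := hC z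
        rw [map_sub, evalAt_mono, map_one, pow_one] at hb
        rw [if_pos h2]
        simp only [Real.rpow_neg (norm_nonneg _), Finset.prod_inv_distrib]
        calc ‖charAt z n - 1‖ / gap z ^ 2 ≤ C * gap z / gap z ^ 2 := by gcongr
          _ = C * (gap z)⁻¹ := by field_simp
          _ ≤ _ := by gcongr
    · refine ⟨2 / d, 1, by positivity, ?_, fun z hz0 => ?_⟩
      · have : (2 : ℝ) < d := by exact_mod_cast lt_of_le_of_ne hd h2.symm
        rw [div_lt_one (by positivity)]
        exact this
      · have hP := hz z hz0
        have hg := prod_norm_rpow_le_gap hdpos z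
        rw [if_neg h2, sub_zero, norm_charAt, one_mul, one_div]
        have e : ∏ i, ‖(z i : ℂ) - 1‖ ^ (-(2 / d) : ℝ)
            = ((∏ i, ‖(z i : ℂ) - 1‖ ^ (1 / d : ℝ)) ^ 2)⁻¹ := by
          rw [← Finset.prod_pow, ← Finset.prod_inv_distrib]
          refine Finset.prod_congr rfl fun i _ => ?_
          rw [Real.rpow_neg (norm_nonneg _), ← Real.rpow_natCast, ← Real.rpow_mul (norm_nonneg _)]
          congr 2
          push_cast
          ring
        rw [e]
        gcongr
  obtain ⟨a, C, ha0, ha1, hC⟩ := key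
  have hint : Integrable (fun t : UnitAddTorus (Fin d) =>
      ∏ i, ‖(AddCircle.toCircle (t i) : ℂ) - 1‖ ^ (-a)) (haarTorus d) :=
    Integrable.fintype_prod (f := fun (_ : Fin d) (x : UnitAddCircle) =>
      ‖(AddCircle.toCircle x : ℂ) - 1‖ ^ (-a))
      fun _ => integrable_norm_toCircle_sub_one_rpow ha0 ha1
  refine (hint.const_mul C).mono' hmeas ((ae_toCircle_ne_one d).mono fun t ht => ?_)
  rw [norm_div, mFourier_eq_charAt, F_eq_gap_sq, norm_pow, Complex.norm_real,
    Real.norm_of_nonneg (gap_nonneg _)]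
  exact hC (torusPoint t) ht

theorem greenIntegral_eq (d : ℕ) (n : Fin d → ℤ) : greenIntegral d n =
    ∫ t, (UnitAddTorus.mFourier (-n) t - if d = 2 then 1 else 0) / F d t ∂(haarTorus d) := by
  rw [greenIntegral]
  split_ifs with h
  · rfl
  · simp only [sub_zero]

/-- If `f · h = g` has a solution `h ∈ ℓ¹`, then this solution is `g · w`: the integrand of `g · w` is
`e^{-2πi⟨n,t⟩} ĝ/F`, and `ĝ/F = ĥ` almost everywhere. For `d = 2` the numerator `-1` does not
contribute because `g(1, …, 1) = 0`. -/
theorem mulW_green_eq {d : ℕ} (hd : 2 ≤ d) {g : R d} {h : W d} (hh : h ∈ ellOne d)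
    (hg : mulW (f d) h = fun n => (g.coeff n : ℝ)) : mulW g (green d) = h := by
  have h1 : (∑ m ∈ g.coeff.support, (g.coeff m : ℂ)) = 0 := by
    have h := evalAt_eq_of_mulW_f_eq hh hg 1
    rw [gap_one, evalAt_eq_sum, Finsupp.sum] at h
    simpa [charAt] using h
  funext n
  apply Complex.ofReal_injective
  have h2 : ((mulW g (green d) n : ℝ) : ℂ) = ∫ t, ∑ m ∈ g.coeff.support, (g.coeff m : ℂ)
      * ((UnitAddTorus.mFourier (-(n - m)) t - if d = 2 then 1 else 0) / F d t)
      ∂(haarTorus d) := by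
    rw [integral_finsetSum _ fun m _ => (integrable_mFourier_div_F hd _).const_mul _]
    simp only [integral_const_mul, ← greenIntegral_eq, greenIntegral_eq_green, mulW, Finsupp.sum]
    push_cast
    rfl
  have h3 : ∀ᵐ t ∂(haarTorus d), (∑ m ∈ g.coeff.support, (g.coeff m : ℂ)
      * ((UnitAddTorus.mFourier (-(n - m)) t - if d = 2 then 1 else 0) / F d t))
      = ∑' m, (h m : ℂ) * UnitAddTorus.mFourier (m - n) t := by
    refine (ae_toCircle_ne_one d).mono fun t ht => ?_
    have hgap : (gap (torusPoint t) : ℂ) ≠ 0 := by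
      have hi := norm_sub_one_le_gap (torusPoint t) ⟨0, by omega⟩
      have := (norm_pos_iff.2 (ht ⟨0, by omega⟩)).trans_le hi
      exact_mod_cast this.ne'
    have e := evalAt_eq_of_mulW_f_eq hh hg (torusPoint t)
    rw [evalAt_eq_sum, Finsupp.sum] at e
    simp only [mFourier_eq_charAt, F_eq_gap_sq, sub_eq_add_neg _ n, charAt_add, neg_sub,
      ← mul_assoc, tsum_mul_right]
    simp only [mul_div_assoc', mul_sub, sub_div, Finset.sum_sub_distrib, ← Finset.sum_div,
      ← Finset.sum_mul, ← mul_assoc, h1, zero_mul, zero_div, sub_zero, e]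
    field_simp
  have h4 := hasSum_integral_of_summable_integral_norm (μ := haarTorus d)
    (F := fun m t => (h m : ℂ) * UnitAddTorus.mFourier (m - n) t)
    (fun m => ((Continuous.integrable_of_hasCompactSupport
      (UnitAddTorus.mFourier (m - n)).continuous
      (HasCompactSupport.of_compactSpace _)).const_mul _)) (by
      simpa [mFourier_eq_charAt, norm_charAt] using mem_ellOne_iff.1 hh)
  rw [h2, integral_congr_ae h3]
  refine h4.unique ?_
  simp only [integral_const_mul, integral_mFourier, sub_eq_zero]
  convert! hasSum_ite_eq n (h n : ℂ) using 2 with m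
  split_ifs with hm
  · rw [hm, mul_one]
  · rw [mul_zero]

end Integrals

/-! ### Taylor expansion at `(1, …, 1)` -/

section Taylor

open Filter Topology

/-- The curve `s ↦ (e^{i s v₁}, …, e^{i s v_d})` through `(1, …, 1)` in the direction `v`. -/
noncomputable def curve {d : ℕ} (v : Fin d → ℝ) (s : ℝ) : Fin d → Circle :=
  fun i => Circle.exp (s * v i)

theorem tendsto_curve {d : ℕ} (v : Fin d → ℝ) : Tendsto (curve v) (𝓝[≠] 0) (𝓝 1) := by
  have hc : Continuous (curve v) := by
    unfold curve
    fun_prop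
  have h0 : curve v 0 = 1 := by
    funext i
    simp [curve]
  exact h0 ▸ (hc.tendsto 0).mono_left nhdsWithin_le_nhds

theorem tendsto_curve_sub_one_div {d : ℕ} (v : Fin d → ℝ) (i : Fin d) :
    Tendsto (fun s : ℝ => ((curve v s i : ℂ) - 1) / s) (𝓝[≠] 0) (𝓝 (Complex.I * v i)) := by
  have h1 : HasDerivAt (fun s : ℝ => ((s : ℂ) * v i) * Complex.I) (Complex.I * v i) 0 := by
    have := (((hasDerivAt_id (0 : ℝ)).ofReal_comp).mul_const (v i : ℂ)).mul_const Complex.I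
    simpa [mul_comm] using this
  have h2 := h1.cexp
  simp only [Complex.ofReal_zero, zero_mul, Complex.exp_zero, one_mul] at h2
  refine (hasDerivAt_iff_tendsto_slope.1 h2).congr fun s => ?_
  simp only [slope, vsub_eq_sub, sub_zero, Complex.ofReal_zero, zero_mul, Complex.exp_zero, curve,
    Circle.coe_exp, Complex.real_smul, Complex.ofReal_inv, Complex.ofReal_mul]
  rw [div_eq_inv_mul]

theorem tendsto_gap_sq_div {d : ℕ} (v : Fin d → ℝ) :
    Tendsto (fun s => gap (curve v s) ^ 2 / s ^ 2) (𝓝[≠] 0) (𝓝 (∑ i, v i ^ 2)) := by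
  have h : Tendsto (fun s : ℝ => ∑ i, ‖((curve v s i : ℂ) - 1) / s‖ ^ 2) (𝓝[≠] 0)
      (𝓝 (∑ i, ‖Complex.I * v i‖ ^ 2)) :=
    tendsto_finsetSum _ fun i _ => (tendsto_curve_sub_one_div v i).norm.pow 2
  simp only [norm_mul, Complex.norm_I, one_mul, Complex.norm_real, Real.norm_eq_abs, sq_abs] at h
  refine h.congr fun s => ?_
  rw [gap_sq, Finset.sum_div]
  exact Finset.sum_congr rfl fun i _ => by rw [norm_div, div_pow, Complex.norm_real,
    Real.norm_eq_abs, sq_abs]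

/-- An element of `𝓘_d^{j+1}` is of order `o(s^j)` along every curve. -/
theorem tendsto_evalAt_curve_div_pow {d : ℕ} (v : Fin d → ℝ) {j : ℕ} {g : R d}
    (hg : g ∈ augIdeal d ^ (j + 1)) :
    Tendsto (fun s : ℝ => evalAt (curve v s) g / (s : ℂ) ^ j) (𝓝[≠] 0) (𝓝 0) := by
  obtain ⟨C, hC0, hC⟩ := exists_norm_evalAt_le _ g hg
  have h1 : Tendsto (fun s => gap (curve v s)) (𝓝[≠] 0) (𝓝 0) :=
    (continuous_gap.tendsto' 1 0 gap_one).comp (tendsto_curve v)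
  have h2 := ((tendsto_gap_sq_div v).sqrt.pow j).mul h1 |>.const_mul C
  rw [mul_zero, mul_zero] at h2
  refine squeeze_zero_norm (fun s => ?_) h2
  have e : √(gap (curve v s) ^ 2 / s ^ 2) = gap (curve v s) / |s| := by
    rw [Real.sqrt_div (sq_nonneg _), Real.sqrt_sq (gap_nonneg _), Real.sqrt_sq_eq_abs]
  rw [e, norm_div, norm_pow, Complex.norm_real, Real.norm_eq_abs, div_pow, div_mul_eq_mul_div,
    ← pow_succ, ← mul_div_assoc]
  gcongr
  exact hC _

theorem continuous_tsum_mul_charAt {d : ℕ} {h : W d} (hh : h ∈ ellOne d) :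
    Continuous fun z : Fin d → Circle => ∑' n, (h n : ℂ) * charAt z n := by
  refine continuous_tsum (fun n => continuous_const.mul (continuous_charAt n))
    (mem_ellOne_iff.1 hh) fun n z => ?_
  rw [norm_mul, norm_charAt, mul_one, Complex.norm_real, Real.norm_eq_abs]

/-- If `f · h = g` with `h ∈ ℓ¹`, then the quadratic part of `g` at `(1, …, 1)` is the square of
the Euclidean norm, up to the factor `∑ h`. -/
theorem tendsto_evalAt_curve_div_sq {d : ℕ} {g : R d} {h : W d} (hh : h ∈ ellOne d)
    (hg : mulW (f d) h = fun n => (g.coeff n : ℝ)) (v : Fin d → ℝ) :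
    Tendsto (fun s : ℝ => evalAt (curve v s) g / (s : ℂ) ^ 2) (𝓝[≠] 0)
      (𝓝 (((∑ i, v i ^ 2 : ℝ) : ℂ) * ((∑' n, h n : ℝ) : ℂ))) := by
  have h1 := ((continuous_tsum_mul_charAt hh).tendsto 1).comp (tendsto_curve v)
  have e1 : ∑' n, (h n : ℂ) * charAt (1 : Fin d → Circle) n = ((∑' n, h n : ℝ) : ℂ) := by
    rw [Complex.ofReal_tsum]
    simp [charAt]
  rw [e1] at h1
  refine ((((Complex.continuous_ofReal.tendsto _).comp (tendsto_gap_sq_div v))).mul h1).congr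
    fun s => ?_
  rw [evalAt_eq_of_mulW_f_eq hh hg]
  simp only [Function.comp_apply]
  push_cast
  ring

theorem sub_intCast_evalOne_mem {d : ℕ} (c : R d) : c - (evalOne d c : R d) ∈ augIdeal d := by
  rw [augIdeal, RingHom.mem_ker, map_sub, map_intCast, Int.cast_id, sub_self]

/-- The class of `g ∈ 𝓘_d` modulo `𝓘_d²`. -/
theorem exists_linear_part {d : ℕ} {g : R d} (hg : g ∈ augIdeal d) : ∃ a : Fin d → ℤ,
    g - ∑ i, (a i : R d) * (mono (Pi.single i 1) - 1) ∈ augIdeal d ^ 2 := by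
  rw [augIdeal_eq_span, Ideal.mem_span_range_iff_exists_fun] at hg
  obtain ⟨c, rfl⟩ := hg
  refine ⟨fun i => evalOne d (c i), ?_⟩
  rw [← Finset.sum_sub_distrib, pow_two]
  refine Ideal.sum_mem _ fun i _ => ?_
  rw [← sub_mul]
  exact Ideal.mul_mem_mul (sub_intCast_evalOne_mem _) (mono_sub_one_mem _)

/-- The class of `g ∈ 𝓘_d²` modulo `𝓘_d³`. -/
theorem exists_quadratic_part {d : ℕ} {g : R d} (hg : g ∈ augIdeal d ^ 2) :
    ∃ a : Fin d → Fin d → ℤ, g - ∑ i, ∑ j, (a i j : R d) *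
      ((mono (Pi.single i 1) - 1) * (mono (Pi.single j 1) - 1)) ∈ augIdeal d ^ 3 := by
  rw [pow_two, ← smul_eq_mul] at hg
  nth_rw 2 [augIdeal_eq_span] at hg
  rw [Ideal.span, Submodule.mem_ideal_smul_span_iff_exists_sum] at hg
  obtain ⟨c, hc, rfl⟩ := hg
  choose a ha using fun i => exists_linear_part (hc i)
  refine ⟨fun i j => a i j, ?_⟩
  rw [Finsupp.sum_fintype _ _ (by simp), ← Finset.sum_sub_distrib, pow_succ]
  refine Ideal.sum_mem _ fun i _ => ?_
  have e : ∑ j, (a i j : R d) * ((mono (Pi.single i 1) - 1) * (mono (Pi.single j 1) - 1))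
      = (∑ j, (a i j : R d) * (mono (Pi.single j 1) - 1)) * (mono (Pi.single i 1) - 1) := by
    rw [Finset.sum_mul]
    exact Finset.sum_congr rfl fun j _ => by ring
  rw [e, smul_eq_mul, ← sub_mul]
  exact Ideal.mul_mem_mul (ha i) (mono_sub_one_mem _)

/-- `f^{(d)} ≡ -∑ᵢ (uᵢ - 1)²` modulo `𝓘_d³`. -/
theorem f_add_sum_sq_mem (d : ℕ) :
    f d + ∑ i : Fin d, (mono (Pi.single i 1) - 1) ^ 2 ∈ augIdeal d ^ 3 := by
  rw [f_eq, ← Finset.sum_add_distrib, pow_succ]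
  refine Ideal.sum_mem _ fun i _ => ?_
  have h1 : (mono (Pi.single i 1) : R d) * mono (-Pi.single i 1) = 1 := by
    rw [mono_mul_mono, add_neg_cancel, mono_zero]
  have e : (mono (Pi.single i 1) - 1 : R d) * (mono (-Pi.single i 1) - 1)
      + (mono (Pi.single i 1) - 1) ^ 2
      = (mono (Pi.single i 1) - 1) ^ 2 * -(mono (-Pi.single i 1) - 1) := by
    linear_combination (mono (Pi.single i 1) - 1) * h1
  rw [e]
  exact Ideal.mul_mem_mul (Ideal.pow_mem_pow (mono_sub_one_mem _) 2)
    (neg_mem (mono_sub_one_mem _))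

/-- The value of a quadratic form whose matrix differs from `b` times the identity by an antisymmetric
matrix. -/
theorem sum_mul_mul_eq_of_antisymm {d : ℕ} {a : Fin d → Fin d → ℤ} {b : ℤ} (hd : ∀ i, a i i = b)
    (ha : ∀ i j, i ≠ j → a i j + a j i = 0) (x : Fin d → R d) :
    ∑ i, ∑ j, (a i j : R d) * (x i * x j) = b * ∑ i, x i ^ 2 := by
  set S := ∑ i, ∑ j, (a i j : R d) * (x i * x j) - b * ∑ i, x i ^ 2 with hS
  have h1 : (b : R d) * ∑ i, x i ^ 2 = ∑ i, ∑ j, if i = j then (b : R d) * (x i * x j) else 0 := by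
    rw [Finset.mul_sum]
    simp [pow_two]
  have h2 : S = -S := by
    have e : S + S = 0 := by
      have hs : S = ∑ i, ∑ j, ((a i j : R d) * (x i * x j)
          - if i = j then (b : R d) * (x i * x j) else 0) := by
        rw [hS, h1]
        simp only [Finset.sum_sub_distrib]
      nth_rw 2 [hs]
      rw [Finset.sum_comm, hs]
      simp only [← Finset.sum_add_distrib]
      refine Finset.sum_eq_zero fun i _ => Finset.sum_eq_zero fun j _ => ?_
      rcases eq_or_ne i j with rfl | hij
      · simp [hd]
      · have h : ((a i j : R d) + (a j i : R d)) = 0 := by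
          rw [← Int.cast_add, ha i j hij, Int.cast_zero]
        rw [if_neg hij, if_neg hij.symm]
        linear_combination x i * x j * h
    exact eq_neg_of_add_eq_zero_left e
  have h3 : S = 0 := by
    ext n
    have h := congrArg (fun p : R d => p.coeff n) h2
    simp only [AddMonoidAlgebra.coeff_neg, Finsupp.neg_apply] at h
    simp only [AddMonoidAlgebra.coeff_zero, Finsupp.zero_apply]
    omega
  exact sub_eq_zero.1 h3

theorem tendsto_evalAt_generator_div {d : ℕ} (v : Fin d → ℝ) (i : Fin d) :
    Tendsto (fun s : ℝ => evalAt (curve v s) (mono (Pi.single i 1) - 1) / s) (𝓝[≠] 0)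
      (𝓝 (Complex.I * v i)) := by
  simpa only [map_sub, evalAt_mono, charAt_single, map_one] using tendsto_curve_sub_one_div v i

/-- If `f · h = g` with `h ∈ ℓ¹`, then `g ≡ a f` modulo `𝓘_d³` for the integer `a = ∑ h`: the
function `ĝ/F = ĥ` is continuous at `(1, …, 1)`, so that the Taylor polynomial of `ĝ` of degree `2`
is a multiple of that of `F`. -/
theorem exists_sub_mul_f_mem {d : ℕ} (hd : 0 < d) {g : R d} {h : W d} (hh : h ∈ ellOne d)
    (hg : mulW (f d) h = fun n => (g.coeff n : ℝ)) :
    ∃ a : ℤ, g - (a : R d) * f d ∈ augIdeal d ^ 3 ∧ ∑' n, h n = a := by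
  have hlim := tendsto_evalAt_curve_div_sq hh hg
  have h1 : g ∈ augIdeal d := by
    have e := evalAt_eq_of_mulW_f_eq hh hg 1
    rw [gap_one, evalAt_one_eq, Complex.ofReal_zero, zero_pow two_ne_zero, zero_mul] at e
    rw [augIdeal, RingHom.mem_ker]
    exact_mod_cast e
  -- `ĝ = O(|t|²)`, so that the linear part of `g` vanishes.
  have h2 : g ∈ augIdeal d ^ 2 := by
    obtain ⟨a, ha⟩ := exists_linear_part h1
    have hv : ∀ v : Fin d → ℝ, ∑ i, (a i : ℂ) * (Complex.I * v i) = 0 := by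
      intro v
      have l1 : Tendsto (fun s : ℝ => ∑ i, (a i : ℂ) *
          (evalAt (curve v s) (mono (Pi.single i 1) - 1) / s)) (𝓝[≠] 0)
          (𝓝 (∑ i, (a i : ℂ) * (Complex.I * v i))) :=
        tendsto_finsetSum _ fun i _ => (tendsto_evalAt_generator_div v i).const_mul _
      have l2 := (tendsto_evalAt_curve_div_pow (j := 1) v ha).add l1
      have l3 : Tendsto (fun s : ℝ => evalAt (curve v s) g / (s : ℂ) ^ 2 * s) (𝓝[≠] 0) (𝓝 0) := by
        have hs : Tendsto (fun s : ℝ => (s : ℂ)) (𝓝[≠] 0) (𝓝 0) :=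
          (Complex.continuous_ofReal.tendsto' 0 0 Complex.ofReal_zero).mono_left
            nhdsWithin_le_nhds
        simpa using (hlim v).mul hs
      rw [zero_add] at l2
      refine tendsto_nhds_unique (l2.congr' ?_) l3
      filter_upwards [self_mem_nhdsWithin] with s hs
      have hs' : (s : ℂ) ≠ 0 := by exact_mod_cast hs
      simp only [map_sub, map_sum, map_mul, map_intCast, ← mul_div_assoc, ← Finset.sum_div,
        pow_one]
      field_simp
      ring
    have ha0 : ∀ i, a i = 0 := by
      intro i
      have h := hv (Pi.single i 1)
      rw [Finset.sum_eq_single i (fun j _ hj => by simp [hj]) (by simp)] at h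
      simpa using h
    simpa [ha0] using ha
  obtain ⟨a, ha⟩ := exists_quadratic_part h2
  have hv : ∀ v : Fin d → ℝ, -∑ i, ∑ j, (a i j : ℝ) * (v i * v j)
      = (∑ i, v i ^ 2) * ∑' n, h n := by
    intro v
    have l1 : Tendsto (fun s : ℝ => ∑ i, ∑ j, (a i j : ℂ) *
        ((evalAt (curve v s) (mono (Pi.single i 1) - 1) / s)
          * (evalAt (curve v s) (mono (Pi.single j 1) - 1) / s))) (𝓝[≠] 0)
        (𝓝 (∑ i, ∑ j, (a i j : ℂ) * ((Complex.I * v i) * (Complex.I * v j)))) :=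
      tendsto_finsetSum _ fun i _ => tendsto_finsetSum _ fun j _ =>
        ((tendsto_evalAt_generator_div v i).mul (tendsto_evalAt_generator_div v j)).const_mul _
    have l2 := (tendsto_evalAt_curve_div_pow (j := 2) v ha).add l1
    rw [zero_add] at l2
    have e := tendsto_nhds_unique (l2.congr fun s => ?_) (hlim v)
    · apply Complex.ofReal_injective
      rw [Complex.ofReal_mul, ← e]
      push_cast
      rw [← Finset.sum_neg_distrib]
      refine Finset.sum_congr rfl fun i _ => ?_
      rw [← Finset.sum_neg_distrib]
      refine Finset.sum_congr rfl fun j _ => ?_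
      linear_combination (-(a i j : ℂ) * v i * v j) * Complex.I_sq
    · have hq : ∀ c x y : ℂ, c * (x / s * (y / s)) = c * (x * y) / s ^ 2 := fun c x y => by ring
      simp only [hq, map_sub, map_sum, map_mul, map_intCast, ← Finset.sum_div, ← add_div,
        sub_add_cancel]
  -- The quadratic forms are compared at the vectors `eᵢ` and `eᵢ + eⱼ`.
  have hdiag : ∀ i, -(a i i : ℝ) = ∑' n, h n := by
    intro i
    have e := hv (Pi.single i 1)
    rw [Finset.sum_eq_single i (fun j _ hj => by simp [hj]) (by simp),
      Finset.sum_eq_single i (fun j _ hj => by simp [hj]) (by simp),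
      Finset.sum_eq_single i (fun j _ hj => by simp [hj]) (by simp)] at e
    simpa using e
  have hanti : ∀ i j, i ≠ j → a i j + a j i = 0 := by
    intro i j hij
    have e := hv (Pi.single i 1 + Pi.single j 1)
    have hi := hdiag i
    have hj := hdiag j
    have hs : ∀ φ : Fin d → ℝ, ∑ k, φ k * (Pi.single i 1 + Pi.single j 1 : Fin d → ℝ) k
        = φ i + φ j := by
      intro φ
      simp [mul_add, Finset.sum_add_distrib, Pi.single_apply]
    have e1 : ∑ k, ∑ l, (a k l : ℝ) * ((Pi.single i 1 + Pi.single j 1 : Fin d → ℝ) k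
        * (Pi.single i 1 + Pi.single j 1 : Fin d → ℝ) l)
        = (a i i + a i j) + (a j i + a j j) := by
      have : ∀ k, ∑ l, (a k l : ℝ) * ((Pi.single i 1 + Pi.single j 1 : Fin d → ℝ) k
          * (Pi.single i 1 + Pi.single j 1 : Fin d → ℝ) l)
          = (a k i + a k j) * (Pi.single i 1 + Pi.single j 1 : Fin d → ℝ) k := by
        intro k
        rw [← hs (fun l => (a k l : ℝ)), Finset.sum_mul]
        exact Finset.sum_congr rfl fun l _ => by ring
      rw [Finset.sum_congr rfl fun k _ => this k, hs]
    have e2 : ∑ k, (Pi.single i 1 + Pi.single j 1 : Fin d → ℝ) k ^ 2 = 2 := by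
      simp only [pow_two]
      rw [hs]
      simp [hij, hij.symm]
      norm_num
    rw [e1, e2] at e
    have : ((a i j + a j i : ℤ) : ℝ) = 0 := by
      push_cast
      linarith
    exact_mod_cast this
  refine ⟨-a ⟨0, hd⟩ ⟨0, hd⟩, ?_, by rw [← hdiag ⟨0, hd⟩]; push_cast; rfl⟩
  have hb : ∀ i, a i i = a ⟨0, hd⟩ ⟨0, hd⟩ := by
    intro i
    have : (a i i : ℝ) = a ⟨0, hd⟩ ⟨0, hd⟩ := neg_injective ((hdiag i).trans (hdiag _).symm)
    exact_mod_cast this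
  rw [sum_mul_mul_eq_of_antisymm hb hanti] at ha
  have h := Ideal.add_mem _ ha (Ideal.mul_mem_left _ (a ⟨0, hd⟩ ⟨0, hd⟩ : R d)
    (f_add_sum_sq_mem d))
  convert h using 1
  push_cast
  ring

/-- The integer `a` of `exists_sub_mul_f_mem` is `0` for `g ∈ 𝓘_d³`, as `ĝ = o(F)`. -/
theorem tsum_eq_zero_of_mem {d : ℕ} (hd : 0 < d) {g : R d} {h : W d} (hh : h ∈ ellOne d)
    (hg : mulW (f d) h = fun n => (g.coeff n : ℝ)) (hg3 : g ∈ augIdeal d ^ 3) :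
    ∑' n, h n = 0 := by
  have e := tendsto_nhds_unique (tendsto_evalAt_curve_div_sq hh hg 1)
    (tendsto_evalAt_curve_div_pow (j := 2) 1 hg3)
  have hd0 : d ≠ 0 := hd.ne'
  simpa [hd0] using e

end Taylor

/-! ### The maps `ξ_g` and the Poisson equation on finite quotients -/

theorem mulW_mul {d : ℕ} (g h : R d) (w : W d) : mulW (g * h) w = mulW g (mulW h w) := by
  have hadd : ∀ (k : R d) (u v : W d), mulW k (u + v) = mulW k u + mulW k v := by
    intro k u v
    funext n
    simp only [mulW, Pi.add_apply, mul_add]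
    exact Finsupp.sum_add
  induction g using AddMonoidAlgebra.induction_linear with
  | zero => funext n; simp [mulW]
  | add p q hp hq => rw [add_mul, mulW_add, mulW_add, hp, hq]
  | single k a =>
    induction h using AddMonoidAlgebra.induction_linear with
    | zero => funext n; simp [mulW]
    | add p q hp hq => rw [mul_add, mulW_add, mulW_add, hadd, hp, hq]
    | single l b =>
      funext n
      rw [AddMonoidAlgebra.single_mul_single, mulW_single, mulW_single, mulW_single, ← sub_sub]
      push_cast
      ring

theorem mulW_delta {d : ℕ} (g : R d) :
    mulW g (fun n => (1 : AddMonoidAlgebra ℝ (Fin d → ℤ)).coeff n)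
      = fun n => (g.coeff n : ℝ) := by
  rw [mulW_coeff, mul_one]
  simp only [toReal_coeff]

/-- The fundamental equation `f · w = 1`. -/
theorem mulW_f_green {d : ℕ} (hd : 2 ≤ d) :
    mulW (f d) (green d) = fun n => (1 : AddMonoidAlgebra ℝ (Fin d → ℤ)).coeff n := by
  refine mulW_green_eq hd ?_ (mulW_delta _)
  rw [mem_ellOne_iff]
  refine summable_of_ne_finset_zero (s := (1 : AddMonoidAlgebra ℝ (Fin d → ℤ)).coeff.support)
    fun n hn => ?_
  rw [Finsupp.notMem_support_iff.1 hn, abs_zero]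

theorem mulW_f_mulW_green {d : ℕ} (hd : 2 ≤ d) (g : R d) :
    mulW (f d) (mulW g (green d)) = fun n => (g.coeff n : ℝ) := by
  rw [← mulW_mul, mul_comm, mulW_mul, mulW_f_green hd, mulW_delta]

theorem mem_I_of_mem_augIdeal_pow {d : ℕ} (hd : 2 ≤ d) {g : R d} (hg : g ∈ augIdeal d ^ 3) :
    g ∈ I d := by
  obtain ⟨h, hh, e⟩ := exists_mulW_f_eq_of_mem (by omega) hg
  rw [I, Set.mem_ofPred_eq, mulW_green_eq hd hh e]
  exact hh

theorem summable_mul_shift {d : ℕ} {h y : W d} (hh : h ∈ ellOne d) (hy : y ∈ ellInf d)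
    (n : Fin d → ℤ) : Summable fun m => h m * y (m + n) := by
  obtain ⟨C, hC⟩ := memℓp_infty_iff.1 hy
  refine Summable.of_norm_bounded ((mem_ellOne_iff.1 hh).mul_right C) fun m => ?_
  rw [norm_mul]
  exact mul_le_mul_of_nonneg_left (hC ⟨m + n, rfl⟩) (norm_nonneg _)

/-- The operator `f(σ)` is symmetric. -/
theorem evalSigma_mulW_f {d : ℕ} {h y : W d} (hh : h ∈ ellOne d) (hy : y ∈ ellInf d) :
    evalSigma h (mulW (f d) y) = evalSigma (mulW (f d) h) y := by
  funext n
  have hT : ∀ k, HasSum (fun m => h m * y (m + k)) (evalSigma h y k) := fun k =>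
    (summable_mul_shift hh hy k).hasSum
  have h1 : HasSum (fun m => h m * mulW (f d) y (m + n))
      (2 * d * evalSigma h y n - ∑ i, (evalSigma h y (n + Pi.single i 1)
        + evalSigma h y (n - Pi.single i 1))) := by
    have e : ∀ m, h m * mulW (f d) y (m + n) = 2 * d * (h m * y (m + n))
        - ∑ i, (h m * y (m + (n + Pi.single i 1)) + h m * y (m + (n - Pi.single i 1))) := by
      intro m
      simp only [mulW_f, mul_sub, ← mul_add, ← Finset.mul_sum, add_sub_assoc, add_assoc]
      ring
    simp only [e]
    exact ((hT n).mul_left (2 * d : ℝ)).sub (hasSum_sum fun i _ =>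
      (hT (n + Pi.single i 1)).add (hT (n - Pi.single i 1)))
  have h2 : HasSum (fun m => mulW (f d) h m * y (m + n))
      (2 * d * evalSigma h y n - ∑ i, (evalSigma h y (n + Pi.single i 1)
        + evalSigma h y (n - Pi.single i 1))) := by
    have hs : ∀ k, HasSum (fun m => h (m + k) * y (m + n)) (evalSigma h y (n - k)) := by
      intro k
      have := (Equiv.addRight k).hasSum_iff.2 (hT (n - k))
      simpa [Function.comp_def] using this
    have hs' : ∀ k, HasSum (fun m => h (m - k) * y (m + n)) (evalSigma h y (n + k)) := by
      intro k
      simpa only [← sub_eq_add_neg, sub_neg_eq_add] using hs (-k)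
    have e : ∀ m, mulW (f d) h m * y (m + n) = 2 * d * (h m * y (m + n))
        - ∑ i, (h (m - Pi.single i 1) * y (m + n) + h (m + Pi.single i 1) * y (m + n)) := by
      intro m
      simp only [mulW_f, sub_mul, ← add_mul, ← Finset.sum_mul]
      simp only [add_comm (h (m - _)), mul_assoc]
    simp only [e]
    exact ((hT n).mul_left (2 * d : ℝ)).sub (hasSum_sum fun i _ =>
      (hs' (Pi.single i 1)).add (hs (Pi.single i 1)))
  exact h1.tsum_eq.trans h2.tsum_eq.symm

/-- The value of `ξ̄_g` on `f · y + c`. -/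
theorem xi_mulW_f_add_const {d : ℕ} (hd : 2 ≤ d) {g : R d} (hg : g ∈ I d) {y : W d}
    (hy : y ∈ ellInf d) (c : ℝ) (n : Fin d → ℤ) :
    xi g (mulW (f d) y + const c) n
      = evalAlpha g (rho y) n + ((∑' m, mulW g (green d) m) * c : ℝ) := by
  have hc : const c ∈ ellInf d := memℓp_infty ⟨‖c‖, by rintro _ ⟨n, rfl⟩; exact le_rfl⟩
  have hf : mulW (f d) y ∈ ellInf d := by
    have h := mulW_f_bounded hy 0
    have e : mulW (f d) y + const 0 = mulW (f d) y := funext fun n => add_zero _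
    rwa [e] at h
  have e1 : xiBar g (mulW (f d) y + const c) n
      = xiBar g (mulW (f d) y) n + (∑' m, mulW g (green d) m) * c := by
    simp only [xiBar, evalSigma, Pi.add_apply, mul_add]
    rw [(summable_mul_shift hg hf n).tsum_add (summable_mul_shift hg hc n)]
    simp only [const, tsum_mul_right]
  have e2 : xiBar g (mulW (f d) y) n = g.coeff.sum fun m a => (a : ℝ) * y (m + n) := by
    rw [xiBar, evalSigma_mulW_f hg hy, mulW_f_mulW_green hd]
    refine tsum_eq_sum fun m hm => ?_
    simp [Finsupp.notMem_support_iff.1 hm]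
  have hs : ∀ (s : Finset (Fin d → ℤ)) (φ : (Fin d → ℤ) → ℝ),
      ((∑ i ∈ s, φ i : ℝ) : UnitAddCircle) = ∑ i ∈ s, (φ i : UnitAddCircle) :=
    fun s φ => map_sum (QuotientAddGroup.mk' (AddSubgroup.zmultiples (1 : ℝ))) φ s
  rw [xi, rho, e1, e2, AddCircle.coe_add, Finsupp.sum, hs, evalAlpha, Finsupp.sum]
  congr 1
  refine Finset.sum_congr rfl fun m _ => ?_
  rw [rho, ← zsmul_eq_mul, AddCircle.coe_zsmul]

theorem evalAlpha_intCast_mul {d : ℕ} (a : ℤ) (g : R d) (x : TZ d) :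
    evalAlpha ((a : R d) * g) x = a • evalAlpha g x := by
  rw [← zsmul_eq_mul]
  exact map_zsmul (AddMonoidHom.mk' (fun g : R d => evalAlpha g x) fun g h => evalAlpha_add g h x)
    a g

theorem coe_intCast_eq_zero (k : ℤ) : (((k : ℤ) : ℝ) : UnitAddCircle) = 0 :=
  (AddCircle.coe_eq_zero_iff (1 : ℝ)).2 ⟨k, by simp⟩

/-- Points of `X_{𝓘_d³}` give elements of the common kernel: if `g ≡ a f` modulo `𝓘_d³`, then the value
of `ξ_g` on `f · y + c` is `a ρ(f · y + c)`. -/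
theorem mulW_f_add_const_mem_K {d : ℕ} (hd : 2 ≤ d) {y : W d} (hy : y ∈ ellInf d)
    (hX : rho y ∈ X (augIdeal d ^ 3)) {c : ℝ} (hc : mulW (f d) y + const c ∈ ellInfInt d) :
    mulW (f d) y + const c ∈ K d := by
  refine ⟨hc, fun g hg => funext fun n => ?_⟩
  obtain ⟨a, ha, hs⟩ := exists_sub_mul_f_mem (by omega) hg (mulW_f_mulW_green hd g)
  have e : evalAlpha g (rho y) = a • rho (mulW (f d) y) := by
    have h := hX _ ha
    rwa [evalAlpha_sub, evalAlpha_intCast_mul, sub_eq_zero, ← rho_mulW_f] at h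
  obtain ⟨k, hk⟩ := hc.2 n
  rw [Pi.add_apply, const] at hk
  rw [xi_mulW_f_add_const hd hg hy, e, hs, Pi.smul_apply, rho, ← AddCircle.coe_zsmul,
    ← AddCircle.coe_add, zsmul_eq_mul, ← mul_add, hk, ← Int.cast_mul]
  exact coe_intCast_eq_zero _

section MaximumPrinciple

variable {d : ℕ} {Γ : AddSubgroup (Fin d → ℤ)}

/-- A subharmonic function on the finite group `ℤ^d/Γ` is constant. -/
theorem eq_of_subharmonic [Finite ((Fin d → ℤ) ⧸ Γ)] {y : (Fin d → ℤ) ⧸ Γ → ℝ}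
    (hy : ∀ q, 2 * d * y q ≤ ∑ i : Fin d, (y (q + (Pi.single i 1 : Fin d → ℤ))
      + y (q - (Pi.single i 1 : Fin d → ℤ)))) (p q : (Fin d → ℤ) ⧸ Γ) : y p = y q := by
  obtain ⟨q₀, hq₀⟩ := Finite.exists_max y
  have hstep : ∀ q, y q = y q₀ → ∀ i : Fin d, y (q + (Pi.single i 1 : Fin d → ℤ)) = y q₀ ∧
      y (q - (Pi.single i 1 : Fin d → ℤ)) = y q₀ := by
    intro q hq i
    have h0 : ∑ i : Fin d, ((y q₀ - y (q + (Pi.single i 1 : Fin d → ℤ)))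
        + (y q₀ - y (q - (Pi.single i 1 : Fin d → ℤ)))) ≤ 0 := by
      have h := hy q
      have e : ∑ i : Fin d, ((y q₀ - y (q + (Pi.single i 1 : Fin d → ℤ)))
          + (y q₀ - y (q - (Pi.single i 1 : Fin d → ℤ)))) = 2 * d * y q₀
          - ∑ i : Fin d, (y (q + (Pi.single i 1 : Fin d → ℤ))
            + y (q - (Pi.single i 1 : Fin d → ℤ))) := by
        rw [eq_sub_iff_add_eq, ← Finset.sum_add_distrib]
        have : ∀ i : Fin d, y q₀ - y (q + (Pi.single i 1 : Fin d → ℤ))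
            + (y q₀ - y (q - (Pi.single i 1 : Fin d → ℤ)))
            + (y (q + (Pi.single i 1 : Fin d → ℤ)) + y (q - (Pi.single i 1 : Fin d → ℤ)))
            = 2 * y q₀ := fun i => by ring
        simp only [this]
        rw [Finset.sum_const, Finset.card_univ, Fintype.card_fin, nsmul_eq_mul]
        ring
      rw [e]
      rw [hq] at h
      linarith
    have h1 : ∀ i ∈ Finset.univ, 0 ≤ (y q₀ - y (q + (Pi.single i 1 : Fin d → ℤ)))
        + (y q₀ - y (q - (Pi.single i 1 : Fin d → ℤ))) := fun i _ =>
      add_nonneg (sub_nonneg.2 (hq₀ _)) (sub_nonneg.2 (hq₀ _))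
    have h2 := (Finset.sum_eq_zero_iff_of_nonneg h1).1 (le_antisymm h0 (Finset.sum_nonneg h1)) i
      (Finset.mem_univ i)
    have h3 := hq₀ (q + (Pi.single i 1 : Fin d → ℤ))
    have h4 := hq₀ (q - (Pi.single i 1 : Fin d → ℤ))
    constructor <;> linarith
  let S : AddSubmonoid (Fin d → ℤ) :=
    { carrier := {n | ∀ q, y q = y q₀ → y (q + n) = y q₀}
      zero_mem' := fun q hq => by rwa [QuotientAddGroup.mk_zero, add_zero]
      add_mem' := fun {m n} hm hn q hq => by
        rw [QuotientAddGroup.mk_add, ← add_assoc]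
        exact hn _ (hm _ hq) }
  have hS : S = ⊤ := by
    refine addSubmonoid_eq_top_of_single_mem S (fun i q hq => (hstep q hq i).1) fun i q hq => ?_
    rw [QuotientAddGroup.mk_neg, ← sub_eq_add_neg]
    exact (hstep q hq i).2
  have hall : ∀ q, y q = y q₀ := by
    intro q
    obtain ⟨n, hn⟩ := QuotientAddGroup.mk_surjective (q - q₀)
    have : n ∈ S := hS ▸ AddSubmonoid.mem_top n
    have h := this q₀ rfl
    rwa [hn, add_sub_cancel] at h
  rw [hall p, hall q]

/-- The map `y ↦ f · y + y(0)` on the functions on `ℤ^d/Γ`. The kernel of `y ↦ f · y` consists of the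
constants; the summand `y(0)` makes the map injective, hence bijective. -/
noncomputable def laplaceAddEval (Γ : AddSubgroup (Fin d → ℤ)) :
    ((Fin d → ℤ) ⧸ Γ → ℝ) →ₗ[ℝ] ((Fin d → ℤ) ⧸ Γ → ℝ) where
  toFun y q := 2 * d * y q - ∑ i : Fin d, (y (q + (Pi.single i 1 : Fin d → ℤ))
    + y (q - (Pi.single i 1 : Fin d → ℤ))) + y 0
  map_add' y z := by
    funext q
    simp only [Pi.add_apply, Finset.sum_add_distrib]
    ring
  map_smul' c y := by
    funext q
    simp only [Pi.smul_apply, smul_eq_mul, RingHom.id_apply, ← mul_add, ← Finset.mul_sum]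
    ring

theorem laplaceAddEval_injective [Finite ((Fin d → ℤ) ⧸ Γ)] :
    Function.Injective (laplaceAddEval Γ) := by
  refine (injective_iff_map_eq_zero _).2 fun y hy => ?_
  have h : ∀ q, 2 * d * y q - ∑ i : Fin d, (y (q + (Pi.single i 1 : Fin d → ℤ))
      + y (q - (Pi.single i 1 : Fin d → ℤ))) + y 0 = 0 := fun q => congrFun hy q
  -- `f · y` is the constant `-y(0)`, so that `y` or `-y` is subharmonic.
  have hconst : ∀ p q, y p = y q := by
    rcases le_total 0 (y 0) with h0 | h0
    · exact eq_of_subharmonic fun q => by linarith [h q]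
    · have hn := eq_of_subharmonic (y := -y) (Γ := Γ) fun q => by
        simp only [Pi.neg_apply, ← neg_add, Finset.sum_neg_distrib]
        linarith [h q]
      exact fun p q => neg_injective (hn p q)
  have h0 : y 0 = 0 := by
    have e := h 0
    simp only [hconst _ 0, Finset.sum_const, Finset.card_univ, Fintype.card_fin,
      nsmul_eq_mul] at e
    linarith
  funext q
  rw [hconst q 0, h0, Pi.zero_apply]

/-- The Poisson equation for `Γ`-invariant functions. -/
theorem exists_invariant_solution (hΓ : Γ.FiniteIndex) {v : W d} (hv : IsInvariant Γ v) :
    ∃ y ∈ ellInf d, IsInvariant Γ y ∧ ∃ c : ℝ, v = mulW (f d) y + const c := by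
  have : Finite ((Fin d → ℤ) ⧸ Γ) := AddSubgroup.finite_quotient_of_finiteIndex
  have hq : ∀ n : Fin d → ℤ, v (Quotient.out (n : (Fin d → ℤ) ⧸ Γ)) = v n := by
    intro n
    obtain ⟨γ, hγ⟩ := QuotientAddGroup.mk_out_eq_add Γ n
    rw [hγ, add_comm]
    exact hv γ γ.2 n
  obtain ⟨y, hy⟩ := LinearMap.injective_iff_surjective.1 (laplaceAddEval_injective (Γ := Γ))
    fun q => v q.out
  refine ⟨fun n => y n, ?_, ?_, y 0, ?_⟩
  · obtain ⟨C, hC⟩ := (Set.finite_range fun q => ‖y q‖).bddAbove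
    refine memℓp_infty ⟨C, ?_⟩
    rintro _ ⟨n, rfl⟩
    exact hC ⟨(n : (Fin d → ℤ) ⧸ Γ), rfl⟩
  · intro γ hγ n
    have : ((γ + n : Fin d → ℤ) : (Fin d → ℤ) ⧸ Γ) = n := by
      rw [QuotientAddGroup.mk_add, (QuotientAddGroup.eq_zero_iff γ).2 hγ, zero_add]
    simp only [this]
  · funext n
    have h := congrFun hy (n : (Fin d → ℤ) ⧸ Γ)
    rw [hq] at h
    rw [Pi.add_apply, mulW_f, ← h]
    rfl

end MaximumPrinciple

end HarmonicModel

open HarmonicModel in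
theorem theorem3p9 (d : ℕ) (hd : 2 ≤ d) :
    (∀ (y : HarmonicModel.W d) (hy : y ∈ HarmonicModel.ellInf d)
      (hX : HarmonicModel.rho y ∈ HarmonicModel.X (HarmonicModel.augIdeal d ^ 3)) (m : ℤ),
      HarmonicModel.mulW (HarmonicModel.f d) y + HarmonicModel.const (HarmonicModel.cst y hy hX)
        + HarmonicModel.const (m : ℝ) ∈ HarmonicModel.K d) ∧
    (∀ Γ : AddSubgroup (Fin d → ℤ), Γ.FiniteIndex →
      ∀ v ∈ HarmonicModel.ellInfInt d, HarmonicModel.IsInvariant Γ v →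
        (v ∈ HarmonicModel.K d ↔
          ∃ (y : HarmonicModel.W d) (hy : y ∈ HarmonicModel.ellInf d)
            (hX : HarmonicModel.rho y ∈ HarmonicModel.X (HarmonicModel.augIdeal d ^ 3)) (m : ℤ),
            HarmonicModel.IsInvariant Γ y ∧
            v = HarmonicModel.mulW (HarmonicModel.f d) y
              + HarmonicModel.const (HarmonicModel.cst y hy hX)
              + HarmonicModel.const (m : ℝ))) := by
  have part1 : ∀ (y : W d) (hy : y ∈ ellInf d) (hX : rho y ∈ X (augIdeal d ^ 3)) (m : ℤ),
      mulW (f d) y + const (cst y hy hX) + const (m : ℝ) ∈ K d := by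
    intro y hy hX m
    have e : mulW (f d) y + const (cst y hy hX) + const (m : ℝ)
        = mulW (f d) y + const (cst y hy hX + m) := funext fun n => add_assoc _ _ _
    rw [e]
    refine mulW_f_add_const_mem_K hd hy hX ⟨mulW_f_bounded hy _, fun n => ?_⟩
    obtain ⟨k, hk⟩ := (cst_spec y hy hX).2.2 n
    refine ⟨k + m, ?_⟩
    rw [← e, Pi.add_apply, hk, const, Int.cast_add]
  refine ⟨part1, fun Γ hΓ v hv hvΓ => ⟨fun hK => ?_, ?_⟩⟩
  · obtain ⟨y, hy, hyΓ, c, rfl⟩ := exists_invariant_solution hΓ hvΓ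
    have hX : rho y ∈ X (augIdeal d ^ 3) := by
      intro g hg
      funext n
      have hI := mem_I_of_mem_augIdeal_pow hd hg
      have h := congrFun (hK.2 g hI) n
      rwa [xi_mulW_f_add_const hd hI hy,
        tsum_eq_zero_of_mem (by omega) hI (mulW_f_mulW_green hd g) hg, zero_mul,
        AddCircle.coe_zero, add_zero] at h
    obtain ⟨k, hk⟩ := hv.2 0
    obtain ⟨l, hl⟩ := (cst_spec y hy hX).2.2 0
    refine ⟨y, hy, hX, k - l, hyΓ, funext fun n => ?_⟩
    simp only [Pi.add_apply, const] at hk hl ⊢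
    push_cast
    linarith
  · rintro ⟨y, hy, hX, m, -, rfl⟩
    exact part1 y hy hX m
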